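/- Let $k, K$ be positive kernel functions on a set $X$ (functions $X\times X\to\mathbb C$ such that $[k(x_i,x_j)]$ is positive semidefinite for all finite families of points), and let $\mathcal H(k),\mathcal H(K)$ be their reproducing kernel Hilbert spaces of functions on $X$, with kernel vectors $k_x,K_x$, so that $\langle k_x,f\rangle=f(x)$ and $\langle k_x,k_y\rangle=k(x,y)$; inner products and forms are conjugate linear in the first variable. Assume that $\mathfrak q_k(K_x,K_y):=k(x,y)$ is a well-defined sesquilinear form on the linear span $\bigvee_{x}K_x$ in $\mathcal H(K)$, i.e. that $\sum_i c_iK_{x_i}=0$ implies $\sum_i c_ik_{x_i}=0$ for all finite linear combinations. Then $\mathfrak q_k$ is a densely defined, positive semidefinite form in $\mathcal H(K)$. For densely defined positive semidefinite forms write $\mathfrak p\le\mathfrak q$ if $\mathrm{Dom}\,\mathfrak q\subseteq\mathrm{Dom}\,\mathfrak p$ and $\mathfrak p(u,u)\le\mathfrak q(u,u)$ for all $u\in\mathrm{Dom}\,\mathfrak q$. A form $\mathfrak q$ is closed if its domain is complete in the norm $(\|u\|^2+\mathfrak q(u,u))^{1/2}$, closeable if it has a closed extension (its closure $\overline{\mathfrak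 q}$ is the minimal one), and singular if the only closeable form $\mathfrak p\le\mathfrak q$ is identically zero. The Simon--Lebesgue decomposition of $\mathfrak q$ is $\mathfrak q=\mathfrak q_{ac}+\mathfrak q_s$ with $\mathfrak q_{ac},\mathfrak q_s$ forms on $\mathrm{Dom}\,\mathfrak q$, $\mathfrak q_{ac}$ the largest closeable form $\le\mathfrak q$, and $\mathfrak q_s$ singular. For a positive self-adjoint operator $A$, $\mathfrak q_A(u,v):=\langle\sqrt A\,u,\sqrt A\,v\rangle$ on $\mathrm{Dom}\,\mathfrak q_A:=\mathrm{Dom}\,\sqrt A$. **Theorem.** The form $\mathfrak q_k$ has a Simon--Lebesgue decomposition $\mathfrak q_k=\mathfrak q_{ac}+\mathfrak q_s$ in $\mathcal H(K)$, and for this decomposition there are positive kernels $k^{ac},k^s$ on $X$ (for which $\mathfrak q_{k^{ac}},\mathfrak q_{k^s}$ are again well defined on $\bigvee_xK_x$) such that $$\mathfrak q_{ac}=\mathfrak q_{k^{ac}},\qquad \mathfrak q_s=\mathfrak q_{k^s},\qquad k=k^{ac}+k^s,\qquad \mathcal H(k)=\mathcal H(k^{ac})\oplus\mathcal H(k^s),$$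 where the last identity means that both spaces are isometrically contained, as spaces of functions, in $\mathcal H(k)$, are orthogonal there, and together span $\mathcal H(k)$. Moreover $\mathcal H(k^{ac})$ is the closure of $\mathrm{int}(k,K):=\mathcal H(k)\cap\mathcal H(K)$ in the norm of $\mathcal H(k)$. Finally, the embedding $\mathrm e:\mathrm{int}(k,K)\to\mathcal H(K)$, $\mathrm e f=f$, is a densely defined closed operator from this closure to $\mathcal H(K)$, the operator $\mathrm e\mathrm e^*$ is positive and self-adjoint, and $\overline{\mathfrak q_{ac}}=\mathfrak q_{\mathrm e\mathrm e^*}$. -/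

import Mathlib

open Filter Topology
open scoped ComplexOrder

noncomputable section

universe u

/-! ### Positive kernels and their reproducing kernel Hilbert spaces -/

/-- A positive kernel function on a set `X`: a function `k : X × X → ℂ` such that the matrix
`[k (x i) (x j)]` is positive semidefinite for every finite family of points. -/
structure PosKernel (X : Type u) where
  /-- the underlying function of two variables -/
  toFun : X → X → ℂ
  /-- positive semidefiniteness -/
  posSemidef : (Matrix.of toFun).PosSemidef

namespace PosKernel

variable {X : Type u}

instance : CoeFun (PosKernel X) (fun _ => X → X → ℂ) := ⟨PosKernel.toFun⟩

/-- The kernel as an operator valued matrix, with `k x y` acting on `ℂ` by multiplication. -/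
def opMatrix (k : PosKernel X) : Matrix X X (ℂ →L[ℂ] ℂ) :=
  Matrix.of fun x y => k x y • ContinuousLinearMap.id ℂ ℂ

theorem opMatrix_posSemidef (k : PosKernel X) : k.opMatrix.PosSemidef := by
  refine ((RKHS.posSemidef_tfae (K := k.opMatrix)).out 0 2).mpr (And.intro ?_ fun v => ?_)
  · ext x y
    have h := k.posSemidef.1.apply x y
    simp only [Matrix.of_apply] at h
    simp [opMatrix, Matrix.conjTranspose_apply, ← h, star_smul,
      ContinuousLinearMap.star_eq_adjoint, ContinuousLinearMap.adjoint_id]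
  · have h := k.posSemidef.2 v
    refine le_of_le_of_eq (Complex.le_def.mp h).1 ?_
    have hs : ∀ x y, (starRingEnd ℂ) (k x y) = k y x := fun x y => by
      simpa using k.posSemidef.1.apply y x
    simp only [opMatrix, RCLike.inner_apply, Matrix.of_apply, RCLike.re_eq_complex_re]
    simp only [FunLike.coe_smul, Pi.smul_apply, ContinuousLinearMap.id_apply, smul_eq_mul,
      map_mul, hs, Complex.star_def]
    congr 1
    refine Finsupp.sum_congr fun x _ => Finsupp.sum_congr fun y _ => ?_
    ring

instance (k : PosKernel X) : Fact k.opMatrix.PosSemidef := ⟨k.opMatrix_posSemidef⟩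

/-- The reproducing kernel Hilbert space `H(k)`: the Hilbert space of functions on `X` with
reproducing kernel `k`. Elements coerce to functions `X → ℂ`. -/
def H (k : PosKernel X) : Type u := RKHS.OfKernel k.opMatrix

instance (k : PosKernel X) : NormedAddCommGroup k.H :=
  inferInstanceAs (NormedAddCommGroup (RKHS.OfKernel k.opMatrix))

instance (k : PosKernel X) : InnerProductSpace ℂ k.H :=
  inferInstanceAs (InnerProductSpace ℂ (RKHS.OfKernel k.opMatrix))

instance (k : PosKernel X) : CompleteSpace k.H :=
  inferInstanceAs (CompleteSpace (RKHS.OfKernel k.opMatrix))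

instance (k : PosKernel X) : RKHS ℂ k.H X ℂ :=
  inferInstanceAs (RKHS ℂ (RKHS.OfKernel k.opMatrix) X ℂ)

theorem kernel_H (k : PosKernel X) : RKHS.kernel k.H = k.opMatrix :=
  RKHS.OfKernel.kernel_ofKernel

/-- The kernel vector `k_x ∈ H(k)`, i.e. `⟪k_x, f⟫ = f x`. -/
def vec (k : PosKernel X) (x : X) : k.H := RKHS.kerFun k.H x (1 : ℂ)

theorem inner_vec (k : PosKernel X) (x : X) (f : k.H) : inner ℂ (k.vec x) f = f x := by
  simp [vec]

theorem vec_apply (k : PosKernel X) (x y : X) : k.vec y x = k x y := by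
  rw [vec, RKHS.kerFun_apply, kernel_H]
  simp [opMatrix]

theorem inner_vec_vec (k : PosKernel X) (x y : X) : inner ℂ (k.vec x) (k.vec y) = k x y := by
  rw [inner_vec, vec_apply]


/-- The quadratic form of `k` in `H(K)` makes sense: whenever a finite linear combination
`∑ c x • K_x` vanishes, so does `∑ c x • k_x`. This says exactly that `(K_x, K_y) ↦ k x y` extends
to a (necessarily unique) sesquilinear form on the linear span of the vectors `K_x`. -/
def FormDefined (k K : PosKernel X) : Prop :=
  ∀ c : X →₀ ℂ, (∀ y, c.sum (fun x a => a * K y x) = 0) → ∀ y, c.sum (fun x a => a * k y x) = 0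

theorem linearCombination_apply_eq (k : PosKernel X) (c : X →₀ ℂ) (y : X) :
    (Finsupp.linearCombination ℂ k.vec c : k.H) y = c.sum (fun x a => a * k y x) := by
  rw [← inner_vec, Finsupp.linearCombination_apply, Finsupp.sum, inner_sum]
  simp only [inner_smul_right, inner_vec_vec, Finsupp.sum]

theorem FormDefined.ker_le {k K : PosKernel X} (h : k.FormDefined K) :
    LinearMap.ker (Finsupp.linearCombination ℂ K.vec) ≤
      LinearMap.ker (Finsupp.linearCombination ℂ k.vec) := by
  intro c hc
  rw [LinearMap.mem_ker] at hc ⊢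
  refine RKHS.ext fun y => ?_
  rw [linearCombination_apply_eq]
  rw [RKHS.coe_zero]
  refine (h c fun z => ?_) y
  rw [← linearCombination_apply_eq, hc, RKHS.coe_zero, Pi.zero_apply]

/-- The linear span (not closed) of the kernel vectors. -/
def kernelSpan (K : PosKernel X) : Submodule ℂ K.H := Submodule.span ℂ (Set.range K.vec)

theorem vec_mem_kernelSpan (K : PosKernel X) (x : X) : K.vec x ∈ K.kernelSpan :=
  Submodule.subset_span ⟨x, rfl⟩

theorem dense_kernelSpan (K : PosKernel X) : Dense (K.kernelSpan : Set K.H) := by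
  rw [Submodule.dense_iff_topologicalClosure_eq_top, ← Submodule.orthogonal_eq_bot_iff,
    Submodule.eq_bot_iff]
  intro f hf
  refine RKHS.ext fun x => ?_
  rw [← inner_vec, RKHS.coe_zero, Pi.zero_apply]
  exact (Submodule.mem_orthogonal _ _).mp hf _
    (Submodule.le_topologicalClosure _ (K.vec_mem_kernelSpan x))

/-- The linear map `K_x ↦ k_x` on the linear span of the vectors `K_x`. -/
def transfer (k K : PosKernel X) (h : k.FormDefined K) : K.kernelSpan →ₗ[ℂ] k.H :=
  (Submodule.liftQ _ (Finsupp.linearCombination ℂ k.vec) h.ker_le) ∘ₗ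
    (Finsupp.linearCombination ℂ K.vec).quotKerEquivRange.symm.toLinearMap ∘ₗ
      (LinearEquiv.ofEq _ _ (Finsupp.range_linearCombination ℂ).symm).toLinearMap

theorem transfer_vec (k K : PosKernel X) (h : k.FormDefined K) (x : X) :
    transfer k K h ⟨K.vec x, K.vec_mem_kernelSpan x⟩ = k.vec x := by
  have hx : (Finsupp.linearCombination ℂ K.vec).quotKerEquivRange.symm
      ⟨K.vec x, ⟨Finsupp.single x 1, by simp⟩⟩ =
      Submodule.Quotient.mk (Finsupp.single x (1 : ℂ)) := by
    rw [LinearEquiv.symm_apply_eq]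
    apply Subtype.ext
    rw [LinearMap.quotKerEquivRange_apply_mk]
    simp
  change Submodule.liftQ _ (Finsupp.linearCombination ℂ k.vec) h.ker_le
    ((Finsupp.linearCombination ℂ K.vec).quotKerEquivRange.symm _) = _
  refine (congrArg (Submodule.liftQ _ (Finsupp.linearCombination ℂ k.vec) h.ker_le) hx).trans ?_
  rw [Submodule.liftQ_apply]
  simp

end PosKernel

/-! ### Positive quadratic forms -/

section Forms

variable {E : Type u} [NormedAddCommGroup E] [InnerProductSpace ℂ E]

/-- A densely defined, positive semidefinite sesquilinear form in a complex Hilbert space,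
conjugate linear in the first variable. -/
structure PosForm (E : Type u) [NormedAddCommGroup E] [InnerProductSpace ℂ E] where
  /-- the form domain -/
  dom : Submodule ℂ E
  dense_dom : Dense (dom : Set E)
  /-- the form -/
  form : dom →ₗ⋆[ℂ] dom →ₗ[ℂ] ℂ
  nonneg : ∀ x, 0 ≤ form x x

namespace PosForm

/-- The quadratic form `x ↦ q(x, x)`, a nonnegative real number. -/
def quad (q : PosForm E) (x : q.dom) : ℝ := (q.form x x).re

/-- The partial order of forms: `p ≤ q` if `Dom q ⊆ Dom p` and `p(x, x) ≤ q(x, x)` on `Dom q`. -/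
def FormLE (p q : PosForm E) : Prop :=
  ∃ h : q.dom ≤ p.dom, ∀ x : q.dom, p.quad ⟨x, h x.2⟩ ≤ q.quad x

/-- `p` is an extension of `q`. -/
def Extends (p q : PosForm E) : Prop :=
  ∃ h : q.dom ≤ p.dom, ∀ x y : q.dom, p.form ⟨x, h x.2⟩ ⟨y, h y.2⟩ = q.form x y

/-- A form is closed if its domain is complete for the norm `(‖x‖ ^ 2 + q(x, x)) ^ (1 / 2)`. -/
def IsClosedForm (q : PosForm E) : Prop :=
  ∀ u : ℕ → q.dom,
    (∀ ε > 0, ∃ N, ∀ m ≥ N, ∀ n ≥ N, ‖(u m - u n : E)‖ ^ 2 + q.quad (u m - u n) < ε) →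
    ∃ x : q.dom, Tendsto (fun n => ‖(u n - x : E)‖ ^ 2 + q.quad (u n - x)) atTop (𝓝 0)

/-- A form is closeable (absolutely continuous) if it has a closed extension. -/
def Closeable (q : PosForm E) : Prop := ∃ p : PosForm E, p.IsClosedForm ∧ p.Extends q

/-- `p` is the closure of `q`, i.e. its minimal closed extension. -/
def IsClosureOf (p q : PosForm E) : Prop :=
  p.IsClosedForm ∧ p.Extends q ∧ ∀ r : PosForm E, r.IsClosedForm → r.Extends q → r.Extends p

/-- A form is singular if the only closeable form it dominates is identically zero. -/
def Singular (q : PosForm E) : Prop :=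
  ∀ p : PosForm E, p.Closeable → p.FormLE q → ∀ x y : p.dom, p.form x y = 0

/-- `q = p + r` is the Simon--Lebesgue decomposition of `q`: the forms `p` and `r` have the same
domain as `q` and sum up to `q`, the form `p` is the largest closeable form `≤ q`, and `r` is
singular. -/
structure IsSimonLebesgue (q p r : PosForm E) : Prop where
  dom_ac : p.dom = q.dom
  dom_s : r.dom = q.dom
  add : ∀ x y : q.dom, q.form x y =
    p.form ⟨x, dom_ac.ge x.2⟩ ⟨y, dom_ac.ge y.2⟩ + r.form ⟨x, dom_s.ge x.2⟩ ⟨y, dom_s.ge y.2⟩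
  closeable : p.Closeable
  le : p.FormLE q
  maximal : ∀ p' : PosForm E, p'.Closeable → p'.FormLE q → p'.FormLE p
  singular : r.Singular

end PosForm

/-! ### Unbounded operators -/

/-- The composition `g f` of partially defined operators on its natural domain
`{x ∈ Dom f | f x ∈ Dom g}`. -/
def LinearPMap.pcomp {E F G : Type*} [AddCommGroup E] [Module ℂ E] [AddCommGroup F] [Module ℂ F]
    [AddCommGroup G] [Module ℂ G] (g : F →ₗ.[ℂ] G) (f : E →ₗ.[ℂ] F) : E →ₗ.[ℂ] G where
  domain := (g.domain.comap f.toFun).map f.domain.subtype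
  toFun :=
    { toFun := fun x => g ⟨f ⟨x, Submodule.map_subtype_le _ _ x.2⟩, by
          obtain ⟨y, hy, hxy⟩ := x.2
          have : y = ⟨x, Submodule.map_subtype_le _ _ x.2⟩ := Subtype.ext hxy
          exact this ▸ hy⟩
      map_add' := fun x y => 
        (congrArg g (Subtype.ext (f.map_add ⟨x, Submodule.map_subtype_le _ _ x.2⟩
          ⟨y, Submodule.map_subtype_le _ _ y.2⟩))).trans (g.map_add _ _)
      map_smul' := fun c x => 
        (congrArg g (Subtype.ext (f.map_smul c ⟨x, Submodule.map_subtype_le _ _ x.2⟩))).trans (g.map_smul c _) }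

/-- A positive self-adjoint, possibly unbounded, operator. -/
def LinearPMap.IsPosSelfAdjoint [CompleteSpace E] (A : E →ₗ.[ℂ] E) : Prop :=
  IsSelfAdjoint A ∧ ∀ x : A.domain, 0 ≤ inner ℂ (x : E) (A x)

/-- `q` is the form `q_A` of the positive self-adjoint operator `A`: the domain of `q` is the
domain of the positive square root `B = √A` and `q(x, y) = ⟪√A x, √A y⟫`. -/
def PosForm.IsFormOf [CompleteSpace E] (q : PosForm E) (A : E →ₗ.[ℂ] E) : Prop :=
  A.IsPosSelfAdjoint ∧ ∃ B : E →ₗ.[ℂ] E, B.IsPosSelfAdjoint ∧ B.pcomp B = A ∧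
    ∃ h : q.dom = B.domain, ∀ x y : q.dom,
      q.form x y = inner ℂ (B ⟨x, h.le x.2⟩) (B ⟨y, h.le y.2⟩)

end Forms

namespace PosKernel

variable {X : Type u}

/-- The densely defined positive form of `k` in `H(K)`: its domain is the linear span of the
vectors `K_x`, and it takes the value `k x y` at `(K_x, K_y)`. -/
def kernelForm (k K : PosKernel X) (h : k.FormDefined K) : PosForm K.H where
  dom := K.kernelSpan
  dense_dom := K.dense_kernelSpan
  form := LinearMap.mk₂'ₛₗ (starRingEnd ℂ) (RingHom.id ℂ)
    (fun u v => inner ℂ (transfer k K h u) (transfer k K h v))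
    (fun u v w => by rw [map_add, inner_add_left])
    (fun c u v => by rw [map_smul, inner_smul_left, smul_eq_mul])
    (fun u v w => by rw [map_add, inner_add_right])
    (fun c u v => by rw [map_smul, inner_smul_right, RingHom.id_apply, smul_eq_mul])
  nonneg := fun u => by
    rw [LinearMap.mk₂'ₛₗ_apply, inner_self_eq_norm_sq_to_K]
    exact Complex.zero_le_real.mpr (sq_nonneg ‖transfer k K h u‖) |>.trans_eq (by push_cast; rfl)

theorem kernelForm_vec (k K : PosKernel X) (h : k.FormDefined K) (x y : X) :
    (kernelForm k K h).form ⟨K.vec x, K.vec_mem_kernelSpan x⟩ ⟨K.vec y, K.vec_mem_kernelSpan y⟩ =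
      k x y := by
  exact (congrArg₂ (inner ℂ) (transfer_vec k K h x) (transfer_vec k K h y)).trans
    (inner_vec_vec k x y)

/-- The pairs `(f, g) ∈ H(k) × H(K)` such that `f` and `g` are the same function on `X`. -/
def sameFun (k K : PosKernel X) : Submodule ℂ (k.H × K.H) where
  carrier := {p | ∀ x, p.1 x = p.2 x}
  zero_mem' := fun x => by
    rw [Prod.fst_zero, Prod.snd_zero, RKHS.coe_zero, RKHS.coe_zero]
  add_mem' := fun {p r} hp hr x => by
    rw [Prod.fst_add, Prod.snd_add, RKHS.coe_add, RKHS.coe_add, Pi.add_apply, Pi.add_apply,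
      hp x, hr x]
  smul_mem' := fun c p hp x => by
    rw [Prod.smul_fst, Prod.smul_snd, RKHS.coe_smul, RKHS.coe_smul, Pi.smul_apply,
      Pi.smul_apply, hp x]

/-- The intersection space `int(k, K) = H(k) ∩ H(K)`, as a subspace of `H(k)`. -/
def inter (k K : PosKernel X) : Submodule ℂ k.H :=
  (sameFun k K).map (LinearMap.fst ℂ k.H K.H)

/-- The closure of the intersection space in the norm of `H(k)`. -/
def interClosure (k K : PosKernel X) : Submodule ℂ k.H := (inter k K).topologicalClosure

instance (k K : PosKernel X) : CompleteSpace (interClosure k K) :=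
  (inter k K).isClosed_topologicalClosure.completeSpace_coe

/-- The embedding `e : int(k, K) → H(K)`, mapping `f` to the same function `f`, as an operator
from (the closure in `H(k)` of) the intersection space to `H(K)`. -/
def embedding (k K : PosKernel X) : interClosure k K →ₗ.[ℂ] K.H :=
  ((sameFun k K).comap
    ((interClosure k K).subtype.prodMap (LinearMap.id : K.H →ₗ[ℂ] K.H))).toLinearPMap

theorem mem_embedding_domain (k K : PosKernel X) (f : interClosure k K) :
    f ∈ (embedding k K).domain ↔ (f : k.H) ∈ inter k K := by
  constructor
  · rintro ⟨p, hp, rfl⟩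
    exact ⟨(p.1, p.2), hp, rfl⟩
  · rintro ⟨p, hp, hpf⟩
    refine ⟨(f, p.2), fun x => ?_, rfl⟩
    have h1 : p.1 = (f : k.H) := hpf
    have h2 : p.1 x = p.2 x := hp x
    rw [h1] at h2
    exact h2

theorem embedding_apply (k K : PosKernel X) (f : (embedding k K).domain) (x : X) :
    embedding k K f x = (f : k.H) x := by
  have h := Submodule.mem_graph_toLinearPMap (g := (sameFun k K).comap
    ((interClosure k K).subtype.prodMap (LinearMap.id : K.H →ₗ[ℂ] K.H))) (fun p hp hp0 => by
      refine RKHS.ext fun y => ?_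
      have h1 : (p.1 : k.H) y = p.2 y := hp y
      rw [← h1, hp0, Submodule.coe_zero, RKHS.coe_zero, RKHS.coe_zero]) f
  exact (h x).symm

end PosKernel

end

/-! ### Elementary properties of positive forms -/

namespace PosForm

section

variable {E : Type*} [NormedAddCommGroup E] [InnerProductSpace ℂ E]

/-! The form of `k` is `⟪T u, T v⟫`, where `T` is the operator `K_x ↦ k_x` from the span of the
`K_x` in `H(K)` to `H(k)` (`transferOp`). Everything rests on computing `T*`. By the reproducing
property, `⟪T K_x, b⟫ = ⟪K_x, g⟫` says `b x = g x`, so `T* b = g` holds exactly when `b` and `g` are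
the same function. Hence `T*` is the embedding `e` of the intersection space, and `M = interClosure
k K` is the closure of its domain.

Let `P` be the projection onto `M`. The form splits as `‖T u‖² = ‖P T u‖² + ‖(1 - P) T u‖²`. The
first part is closeable, because `P T`, as an operator into `M`, is contained in the closed operator
`e*`. A closeable form below `‖T u‖²` is also controlled along the closure of the graph of `T`
(`quad_le_of_tendsto`). That closure contains every `(u, P T u)`, which gives maximality of the
first part. Likewise `(u, 0)` lies in the closure of the graph of `(1 - P) T`, so the second part is
singular.

Orthogonality in graph spaces shows that `Dom T` is a core for `e*`, so the closure of the first
form is `⟪e* u, e* v⟫`. It is the form of `e e*` by von Neumann's argument: projecting onto the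
graph of `e` gives the resolvent `(1 + e e*)⁻¹`, and bounded functional calculus then gives the
square root. Finally, compressing `k` by `P` and `1 - P` yields kernels whose spaces are `M` and its
orthogonal complement. -/

theorem im_form_self (q : PosForm E) (x : q.dom) : (q.form x x).im = 0 :=
  (Complex.le_def.mp (q.nonneg x)).2.symm

theorem quad_nonneg (q : PosForm E) (x : q.dom) : 0 ≤ q.quad x :=
  (Complex.le_def.mp (q.nonneg x)).1

/-- Positivity makes the form real on the diagonal. Reality at `x + y` and at `x + i y` gives the
two halves of Hermitian symmetry. -/
theorem conj_form (q : PosForm E) (x y : q.dom) : starRingEnd ℂ (q.form x y) = q.form y x := by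
  have h1 := q.im_form_self (x + y)
  have h2 := q.im_form_self (x + Complex.I • y)
  simp only [map_add, LinearMap.add_apply, LinearMap.map_smulₛₗ, map_smul, LinearMap.smul_apply,
    Complex.add_im, smul_eq_mul, Complex.mul_im, Complex.conj_I, Complex.neg_re, Complex.neg_im,
    Complex.I_re, Complex.I_im, q.im_form_self, Complex.add_re, Complex.mul_re] at h1 h2
  have h3 := q.im_form_self y
  refine Complex.ext ?_ ?_
  · rw [Complex.conj_re]
    linarith
  · rw [Complex.conj_im]
    linarith

theorem quad_add_smul (q : PosForm E) (x y : q.dom) (t : ℝ) :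
    q.quad (x + (t : ℂ) • y) = q.quad x + 2 * t * (q.form x y).re + t ^ 2 * q.quad y := by
  have h : (q.form y x).re = (q.form x y).re := by rw [← q.conj_form, Complex.conj_re]
  simp only [quad, map_add, LinearMap.add_apply, LinearMap.map_smulₛₗ, map_smul,
    LinearMap.smul_apply, Complex.add_re, smul_eq_mul, Complex.mul_re, Complex.conj_ofReal,
    Complex.ofReal_re, Complex.ofReal_im, h]
  ring

theorem quad_add (q : PosForm E) (x y : q.dom) :
    q.quad (x + y) = q.quad x + 2 * (q.form x y).re + q.quad y := by
  simpa using q.quad_add_smul x y 1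

theorem quad_neg (q : PosForm E) (x : q.dom) : q.quad (-x) = q.quad x := by
  simp [quad]

/-- The Cauchy-Schwarz inequality for a positive form. -/
theorem re_form_sq_le (q : PosForm E) (x y : q.dom) :
    (q.form x y).re ^ 2 ≤ q.quad x * q.quad y := by
  have h : ∀ t : ℝ, 0 ≤ q.quad y * (t * t) + (2 * (q.form x y).re) * t + q.quad x := fun t => by
    have := q.quad_nonneg (x + (t : ℂ) • y)
    rw [quad_add_smul] at this
    linarith
  have := discrim_le_zero h
  rw [discrim] at this
  linarith

theorem sqrt_quad_add_le (q : PosForm E) (x y : q.dom) :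
    √(q.quad (x + y)) ≤ √(q.quad x) + √(q.quad y) := by
  rw [Real.sqrt_le_left (by positivity), quad_add, add_sq, Real.sq_sqrt (q.quad_nonneg x),
    Real.sq_sqrt (q.quad_nonneg y), mul_assoc, ← Real.sqrt_mul (q.quad_nonneg x)]
  have := Real.le_sqrt_of_sq_le (q.re_form_sq_le x y)
  linarith

theorem abs_sqrt_quad_sub_le (q : PosForm E) (x y : q.dom) :
    |√(q.quad x) - √(q.quad y)| ≤ √(q.quad (x - y)) := by
  have h1 := q.sqrt_quad_add_le (x - y) y
  have h2 := q.sqrt_quad_add_le (-(x - y)) x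
  rw [sub_add_cancel] at h1
  rw [neg_sub, sub_add_cancel, ← neg_sub, quad_neg] at h2
  rw [abs_le]
  constructor <;> linarith

theorem tendsto_quad (q : PosForm E) {u : ℕ → q.dom} {x : q.dom}
    (h : Tendsto (fun n => q.quad (u n - x)) atTop (𝓝 0)) :
    Tendsto (fun n => q.quad (u n)) atTop (𝓝 (q.quad x)) := by
  have h1 : Tendsto (fun n => √(q.quad (u n - x))) atTop (𝓝 0) := by
    simpa [Function.comp_def] using (Real.continuous_sqrt.tendsto 0).comp h
  have h2 : Tendsto (fun n => √(q.quad (u n))) atTop (𝓝 √(q.quad x)) := by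
    rw [tendsto_iff_dist_tendsto_zero]
    exact squeeze_zero (fun _ => dist_nonneg) (fun n => q.abs_sqrt_quad_sub_le _ _) h1
  have h3 := h2.pow 2
  simpa only [Real.sq_sqrt (q.quad_nonneg _)] using h3

theorem form_eq_zero_of_quad_eq_zero (q : PosForm E) (h : ∀ x, q.quad x = 0) (x y : q.dom) :
    q.form x y = 0 := by
  have hre : ∀ x y, (q.form x y).re = 0 := fun x y => by
    have := q.re_form_sq_le x y
    rw [h x, zero_mul] at this
    exact pow_eq_zero_iff (two_ne_zero) |>.mp (le_antisymm this (sq_nonneg _))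
  refine Complex.ext (hre x y) ?_
  -- Replacing `y` by `i y` turns the imaginary part into a real part.
  have h2 := hre x (Complex.I • y)
  rw [map_smul, smul_eq_mul, Complex.I_mul_re] at h2
  simpa using h2

/-- By polarization, it is enough to compare two forms on the diagonal. -/
theorem Extends.of_quad {p q : PosForm E} (h : q.dom ≤ p.dom)
    (hq : ∀ x : q.dom, p.quad ⟨x, h x.2⟩ = q.quad x) : p.Extends q := by
  have hre : ∀ x y : q.dom, (p.form ⟨x, h x.2⟩ ⟨y, h y.2⟩).re = (q.form x y).re := fun x y => by
    have h1 := p.quad_add ⟨x, h x.2⟩ ⟨y, h y.2⟩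
    have h2 := q.quad_add x y
    have h3 := hq (x + y)
    rw [hq x, hq y] at h1
    have h4 : p.quad (⟨x, h x.2⟩ + ⟨y, h y.2⟩) = q.quad (x + y) := h3
    linarith
  refine ⟨h, fun x y => Complex.ext (hre x y) ?_⟩
  have h2 := hre x (Complex.I • y)
  have h3 : p.form ⟨x, h x.2⟩ ⟨(Complex.I • y : q.dom), h (Complex.I • y).2⟩ =
      Complex.I • p.form ⟨x, h x.2⟩ ⟨y, h y.2⟩ := map_smul (p.form ⟨x, h x.2⟩) Complex.I ⟨y, h y.2⟩
  rw [h3, map_smul, smul_eq_mul, smul_eq_mul, Complex.I_mul_re, Complex.I_mul_re] at h2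
  exact neg_injective h2

theorem Extends.quad_eq {p q : PosForm E} (h : p.Extends q) (x : q.dom) :
    p.quad ⟨x, h.1 x.2⟩ = q.quad x :=
  congrArg Complex.re (h.2 x x)

theorem ext_of_form {p q : PosForm E} (h : p.dom = q.dom)
    (hf : ∀ x y : q.dom, p.form ⟨x, h.ge x.2⟩ ⟨y, h.ge y.2⟩ = q.form x y) : p = q := by
  obtain ⟨d, hd, f, hf0⟩ := p
  obtain ⟨d', hd', f', hf0'⟩ := q
  obtain rfl : d = d' := h
  obtain rfl : f = f' := LinearMap.ext₂ hf
  rfl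

theorem ext_of_quad {p q : PosForm E} (h : p.dom = q.dom)
    (hq : ∀ x : q.dom, p.quad ⟨x, h.ge x.2⟩ = q.quad x) : p = q :=
  ext_of_form h (Extends.of_quad h.ge hq).2

/-- A Simon--Lebesgue decomposition is unique. -/
theorem IsSimonLebesgue.unique {q p r p' r' : PosForm E} (h : q.IsSimonLebesgue p r)
    (h' : q.IsSimonLebesgue p' r') : p = p' ∧ r = r' := by
  obtain ⟨h1, h2⟩ := h.maximal p' h'.closeable h'.le
  obtain ⟨h3, h4⟩ := h'.maximal p h.closeable h.le
  -- Each of `p`, `p'` dominates the other by maximality, so they agree on the diagonal; `r` and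
  -- `r'` then agree by cancellation.
  have hp : p = p' := ext_of_quad (le_antisymm h1 h3) fun x =>
    le_antisymm (h4 x) (h2 ⟨x, h1.trans h3 (h3 x.2)⟩)
  refine ⟨hp, ?_⟩
  subst hp
  refine ext_of_form (h.dom_s.trans h'.dom_s.symm) fun x y => ?_
  have := (h.add ⟨x, h'.dom_s.le x.2⟩ ⟨y, h'.dom_s.le y.2⟩).symm.trans
    (h'.add ⟨x, h'.dom_s.le x.2⟩ ⟨y, h'.dom_s.le y.2⟩)
  exact add_left_cancel this

/-- In a closed form, norm limits of sequences which are Cauchy for the form belong to the domain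
and are limits for the form. -/
theorem IsClosedForm.exists_limit {p : PosForm E} (hp : p.IsClosedForm) {w : ℕ → p.dom} {u : E}
    (hu : Tendsto (fun n => (w n : E)) atTop (𝓝 u))
    (hc : ∀ ε > 0, ∃ N, ∀ m ≥ N, ∀ n ≥ N, p.quad (w m - w n) < ε) :
    ∃ h : u ∈ p.dom, Tendsto (fun n => p.quad (w n)) atTop (𝓝 (p.quad ⟨u, h⟩)) := by
  obtain ⟨x, hx⟩ := hp w fun ε hε => by
    obtain ⟨N₁, h₁⟩ := hc (ε / 2) (by positivity)
    obtain ⟨N₂, h₂⟩ := Metric.cauchySeq_iff.mp hu.cauchySeq √(ε / 2) (by positivity)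
    refine ⟨max N₁ N₂, fun m hm n hn => ?_⟩
    have h3 := h₁ m (le_of_max_le_left hm) n (le_of_max_le_left hn)
    have h4 := h₂ m (le_of_max_le_right hm) n (le_of_max_le_right hn)
    rw [dist_eq_norm, Real.lt_sqrt (norm_nonneg _)] at h4
    linarith
  have h1 : Tendsto (fun n => ‖(w n - x : E)‖ ^ 2) atTop (𝓝 0) :=
    squeeze_zero (fun _ => by positivity) (fun n => le_add_of_nonneg_right (p.quad_nonneg _)) hx
  have h2 : Tendsto (fun n => p.quad (w n - x)) atTop (𝓝 0) :=
    squeeze_zero (fun _ => p.quad_nonneg _) (fun n => le_add_of_nonneg_left (by positivity)) hx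
  have h3 : Tendsto (fun n => ‖(w n - x : E)‖) atTop (𝓝 0) := by
    simpa [Function.comp_def, Real.sqrt_sq] using (Real.continuous_sqrt.tendsto 0).comp h1
  have h4 : u = x := tendsto_nhds_unique hu (tendsto_iff_norm_sub_tendsto_zero.mpr h3)
  subst h4
  exact ⟨x.2, p.tendsto_quad h2⟩

end

/-! ### Forms defined by operators -/

variable {E F : Type*} [NormedAddCommGroup E] [InnerProductSpace ℂ E]
  [NormedAddCommGroup F] [InnerProductSpace ℂ F]

/-- The form `(u, v) ↦ ⟪T u, T v⟫` of a densely defined operator `T`. -/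
noncomputable def ofOp (T : E →ₗ.[ℂ] F) (hT : Dense (T.domain : Set E)) : PosForm E where
  dom := T.domain
  dense_dom := hT
  form := LinearMap.mk₂'ₛₗ (starRingEnd ℂ) (RingHom.id ℂ)
    (fun u v => inner ℂ (T u) (T v))
    (fun u v w => by rw [T.map_add, inner_add_left])
    (fun c u v => by rw [T.map_smul, inner_smul_left, smul_eq_mul])
    (fun u v w => by rw [T.map_add, inner_add_right])
    (fun c u v => by rw [T.map_smul, inner_smul_right, RingHom.id_apply, smul_eq_mul])
  nonneg := fun u => by
    rw [LinearMap.mk₂'ₛₗ_apply, inner_self_eq_norm_sq_to_K]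
    exact (Complex.zero_le_real.mpr (sq_nonneg ‖T u‖)).trans_eq (Complex.ofReal_pow _ _)

theorem quad_ofOp (T : E →ₗ.[ℂ] F) (hT : Dense (T.domain : Set E)) (u : T.domain) :
    (ofOp T hT).quad u = ‖T u‖ ^ 2 :=
  inner_self_eq_norm_sq (𝕜 := ℂ) (T u)

theorem quad_ofOp_sub (T : E →ₗ.[ℂ] F) (hT : Dense (T.domain : Set E)) (u v : T.domain) :
    (ofOp T hT).quad (u - v) = dist (T u) (T v) ^ 2 := by
  rw [dist_eq_norm, ← T.map_sub]
  exact quad_ofOp T hT (u - v)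

/-- The form norm is the graph norm of `T`, so completeness of the domain is closedness of the
graph. -/
theorem isClosedForm_ofOp [CompleteSpace E] [CompleteSpace F] {T : E →ₗ.[ℂ] F} (hc : T.IsClosed)
    (hT : Dense (T.domain : Set E)) : (ofOp T hT).IsClosedForm := by
  intro u hu
  have key : ∀ ε > 0, ∃ N, ∀ m ≥ N, ∀ n ≥ N,
      dist (u m : E) (u n) ^ 2 + dist (T (u m)) (T (u n)) ^ 2 < ε ^ 2 := fun ε hε => by
    obtain ⟨N, hN⟩ := hu (ε ^ 2) (by positivity)
    refine ⟨N, fun m hm n hn => ?_⟩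
    have := hN m hm n hn
    rw [← dist_eq_norm] at this
    exact (congrArg _ (quad_ofOp_sub T hT (u m) (u n))).symm.trans_lt this
  have h1 : CauchySeq fun n => (u n : E) := Metric.cauchySeq_iff.mpr fun ε hε => by
    obtain ⟨N, hN⟩ := key ε hε
    refine ⟨N, fun m hm n hn => lt_of_pow_lt_pow_left₀ 2 hε.le ?_⟩
    exact lt_of_le_of_lt (le_add_of_nonneg_right (by positivity)) (hN m hm n hn)
  have h2 : CauchySeq fun n => T (u n) := Metric.cauchySeq_iff.mpr fun ε hε => by
    obtain ⟨N, hN⟩ := key ε hε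
    refine ⟨N, fun m hm n hn => lt_of_pow_lt_pow_left₀ 2 hε.le ?_⟩
    exact lt_of_le_of_lt (le_add_of_nonneg_left (by positivity)) (hN m hm n hn)
  obtain ⟨x, hx⟩ := cauchySeq_tendsto_of_complete h1
  obtain ⟨y, hy⟩ := cauchySeq_tendsto_of_complete h2
  have hxy : (x, y) ∈ T.graph :=
    hc.mem_of_tendsto (hx.prodMk_nhds hy) (Eventually.of_forall fun n => T.mem_graph (u n))
  obtain ⟨z, rfl, rfl⟩ := (LinearPMap.mem_graph_iff T).mp hxy
  refine ⟨z, ?_⟩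
  have h3 := ((tendsto_iff_norm_sub_tendsto_zero.mp hx).pow 2).add
    ((tendsto_iff_dist_tendsto_zero.mp hy).pow 2)
  rw [zero_pow two_ne_zero, add_zero] at h3
  exact h3.congr fun n => (congrArg _ (quad_ofOp_sub T hT (u n) z)).symm

/-- Closeability is used here: `w` is Cauchy for a closed extension `r` of `p`, since `r` is bounded
by `‖T ·‖²` on `Dom T`. So `r (w n)` tends to the value at `u`, while `‖T (w n)‖²` tends to `‖f‖²`.
-/
theorem quad_le_of_tendsto {T : E →ₗ.[ℂ] F} {hT : Dense (T.domain : Set E)} {p : PosForm E}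
    (hp : p.Closeable) (hle : p.FormLE (ofOp T hT)) {u : p.dom} {f : F} {w : ℕ → T.domain}
    (hw : Tendsto (fun n => (w n : E)) atTop (𝓝 (u : E)))
    (hf : Tendsto (fun n => T (w n)) atTop (𝓝 f)) : p.quad u ≤ ‖f‖ ^ 2 := by
  obtain ⟨r, hr, hrp⟩ := hp
  obtain ⟨hd, hle⟩ := hle
  have hr1 : ∀ v : T.domain, r.quad ⟨v, hrp.1 (hd v.2)⟩ ≤ ‖T v‖ ^ 2 := fun v => by
    rw [← quad_ofOp T hT]
    exact (hrp.quad_eq ⟨v, hd v.2⟩).trans_le (hle v)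
  obtain ⟨hu, hlim⟩ := hr.exists_limit (w := fun n => ⟨w n, hrp.1 (hd (w n).2)⟩) hw fun ε hε => by
    obtain ⟨N, hN⟩ := Metric.cauchySeq_iff.mp hf.cauchySeq √ε (by positivity)
    refine ⟨N, fun m hm n hn => (hr1 (w m - w n)).trans_lt ?_⟩
    have := hN m hm n hn
    rwa [dist_eq_norm, ← T.map_sub, Real.lt_sqrt (norm_nonneg _)] at this
  rw [← hrp.quad_eq]
  exact le_of_tendsto_of_tendsto' hlim (hf.norm.pow 2) fun n => hr1 (w n)

/-- If `S` is a closed extension of `T` with core `Dom T`, the form of `S` is the closure of the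
form of `T`. -/
theorem isClosureOf_ofOp [CompleteSpace E] [CompleteSpace F] {S T : E →ₗ.[ℂ] F} (hc : S.IsClosed)
    (hS : Dense (S.domain : Set E)) (hT : Dense (T.domain : Set E)) (hTS : T ≤ S)
    (hcore : ∀ u : S.domain, ∃ w : ℕ → T.domain,
      Tendsto (fun n => (w n : E)) atTop (𝓝 (u : E)) ∧ Tendsto (fun n => T (w n)) atTop (𝓝 (S u))) :
    (ofOp S hS).IsClosureOf (ofOp T hT) := by
  refine ⟨isClosedForm_ofOp hc hS, Extends.of_quad hTS.1 fun x => ?_, fun r hr hrT => ?_⟩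
  · change (ofOp S hS).quad (⟨x, hTS.1 x.2⟩ : S.domain) = (ofOp T hT).quad (x : T.domain)
    refine (quad_ofOp S hS _).trans (Eq.trans ?_ (quad_ofOp T hT x).symm)
    exact congrArg (fun y => ‖y‖ ^ 2) (@hTS.2 x ⟨x, hTS.1 x.2⟩ rfl).symm
  · have key : ∀ u : S.domain, ∃ h : (u : E) ∈ r.dom, r.quad ⟨u, h⟩ = (ofOp S hS).quad u := by
      intro u
      obtain ⟨w, hw, hTw⟩ := hcore u
      obtain ⟨hu, hlim⟩ := hr.exists_limit (w := fun n => ⟨w n, hrT.1 (w n).2⟩) hw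
          fun ε hε => by
        obtain ⟨N, hN⟩ := Metric.cauchySeq_iff.mp hTw.cauchySeq √ε (by positivity)
        refine ⟨N, fun m hm n hn => ?_⟩
        have h1 := hrT.quad_eq (w m - w n : T.domain)
        have h2 := hN m hm n hn
        rw [quad_ofOp_sub] at h1
        rw [Real.lt_sqrt dist_nonneg] at h2
        exact h1.trans_lt h2
      refine ⟨hu, ?_⟩
      rw [quad_ofOp]
      refine tendsto_nhds_unique hlim ((hTw.norm.pow 2).congr fun n => ?_)
      rw [← quad_ofOp T hT]
      exact (hrT.quad_eq (w n)).symm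
    exact Extends.of_quad (fun u hu => (key ⟨u, hu⟩).1) fun u => (key u).2

end PosForm

/-! ### Approximation in graphs -/

section Approx

variable {E F : Type*} [NormedAddCommGroup E] [InnerProductSpace ℂ E] [CompleteSpace E]
  [NormedAddCommGroup F] [InnerProductSpace ℂ F] [CompleteSpace F]

/-- The hypothesis is applied to `q`, the component of `p` orthogonal to the closure of `g'`. It
lies in `g` because `g` is closed, and `⟪q, p⟫ = ‖q‖²`. -/
theorem Submodule.mem_topologicalClosure_of_orthogonal {g g' : Submodule ℂ E}
    (hg : IsClosed (g : Set E)) (hle : g' ≤ g) {p : E} (hp : p ∈ g)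
    (h : ∀ q ∈ g, (∀ r ∈ g', inner ℂ r q = 0) → inner ℂ q p = 0) :
    p ∈ g'.topologicalClosure := by
  have : CompleteSpace g'.topologicalClosure := g'.isClosed_topologicalClosure.completeSpace_coe
  have hPp : g'.topologicalClosure.starProjection p ∈ g'.topologicalClosure :=
    Submodule.starProjection_apply_mem _ _
  have hq : p - g'.topologicalClosure.starProjection p ∈ g'.topologicalClosureᗮ :=
    Submodule.sub_starProjection_mem_orthogonal _
  have h1 := h _ (g.sub_mem hp (Submodule.topologicalClosure_minimal _ hle hg hPp)) fun r hr =>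
    (Submodule.mem_orthogonal _ _).mp hq r (g'.le_topologicalClosure hr)
  have h2 : inner ℂ (p - g'.topologicalClosure.starProjection p)
      (p - g'.topologicalClosure.starProjection p) = 0 := by
    rw [inner_sub_right, h1, (Submodule.mem_orthogonal' _ _).mp hq _ hPp, sub_zero]
  rw [inner_self_eq_zero, sub_eq_zero] at h2
  rw [h2]
  exact hPp

theorem Submodule.exists_seq_tendsto_of_orthogonal {g g' : Submodule ℂ (E × F)}
    (hg : IsClosed (g : Set (E × F))) (hle : g' ≤ g) {p : E × F} (hp : p ∈ g)
    (h : ∀ q ∈ g, (∀ r ∈ g', inner ℂ r.1 q.1 + inner ℂ r.2 q.2 = 0) →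
      inner ℂ q.1 p.1 + inner ℂ q.2 p.2 = 0) :
    ∃ w : ℕ → g', Tendsto (fun n => (w n).1.1) atTop (𝓝 p.1) ∧
      Tendsto (fun n => (w n).1.2) atTop (𝓝 p.2) := by
  -- The product carries the sup norm; the Hilbert space structure lives on its `WithLp 2` copy,
  -- with the same topology.
  let Φ := (WithLp.prodContinuousLinearEquiv 2 ℂ E F).toLinearEquiv.toLinearMap
  have h1 := Submodule.mem_topologicalClosure_of_orthogonal (g := g.comap Φ) (g' := g'.comap Φ)
    (p := WithLp.toLp 2 p) (hg.preimage (WithLp.prodContinuousLinearEquiv 2 ℂ E F).continuous)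
    (Submodule.comap_mono hle) hp fun q hq hqr => by
      rw [WithLp.prod_inner_apply]
      exact h _ hq fun r hr => by
        have := hqr (WithLp.toLp 2 r) hr
        rwa [WithLp.prod_inner_apply] at this
  obtain ⟨w, hw, hlim⟩ := mem_closure_iff_seq_limit.mp h1
  have h2 := ((WithLp.prodContinuousLinearEquiv 2 ℂ E F).continuous.tendsto _).comp hlim
  exact ⟨fun n => ⟨Φ (w n), hw n⟩, (continuous_fst.tendsto _).comp h2,
    (continuous_snd.tendsto _).comp h2⟩

/-- A criterion for `(u, f)` to lie in the closure of the graph. When `T` is densely defined, the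
pairs `(a, b)` orthogonal to the graph are those with `T* b = -a`. -/
theorem LinearPMap.exists_seq_tendsto_of_orthogonal (T : E →ₗ.[ℂ] F) {u : E} {f : F}
    (h : ∀ a b, (∀ v : T.domain, inner ℂ (v : E) a + inner ℂ (T v) b = 0) →
      inner ℂ a u + inner ℂ b f = 0) :
    ∃ w : ℕ → T.domain, Tendsto (fun n => (w n : E)) atTop (𝓝 u) ∧
      Tendsto (fun n => T (w n)) atTop (𝓝 f) := by
  obtain ⟨w, h1, h2⟩ := Submodule.exists_seq_tendsto_of_orthogonal (g := ⊤) (g' := T.graph)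
    (p := (u, f)) isClosed_univ le_top Submodule.mem_top fun q _ hq =>
      h q.1 q.2 fun v => hq _ (T.mem_graph v)
  choose v hv1 hv2 using fun n => (LinearPMap.mem_graph_iff T).mp (w n).2
  exact ⟨v, by simpa only [hv1] using h1, by simpa only [hv2] using h2⟩

end Approx

/-! ### The square root of `e e*` -/

namespace LinearPMap

theorem mem_graph_pcomp {E F G : Type*} [AddCommGroup E] [Module ℂ E] [AddCommGroup F] [Module ℂ F]
    [AddCommGroup G] [Module ℂ G] (g : F →ₗ.[ℂ] G) (f : E →ₗ.[ℂ] F) {x : E} {z : G} :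
    (x, z) ∈ (g.pcomp f).graph ↔ ∃ y, (x, y) ∈ f.graph ∧ (y, z) ∈ g.graph := by
  constructor
  · intro h
    obtain ⟨⟨x, hx⟩, rfl, rfl⟩ := (mem_graph_iff _).mp h
    exact ⟨f ⟨x, Submodule.map_subtype_le _ _ hx⟩, f.mem_graph ⟨x, _⟩, g.mem_graph ⟨_, _⟩⟩
  · rintro ⟨y, h1, h2⟩
    obtain ⟨x, rfl, rfl⟩ := (mem_graph_iff _).mp h1
    obtain ⟨y, hy, rfl⟩ := (mem_graph_iff _).mp h2
    have hmem : f.toFun x ∈ g.domain := by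
      have := y.2
      rw [hy] at this
      exact this
    refine (mem_graph_iff _).mpr ⟨⟨x, ⟨x, hmem, rfl⟩⟩, rfl, ?_⟩
    exact congrArg g (Subtype.ext hy.symm)

variable {E F G : Type*} [NormedAddCommGroup E] [InnerProductSpace ℂ E]
  [NormedAddCommGroup F] [InnerProductSpace ℂ F]
  [NormedAddCommGroup G] [InnerProductSpace ℂ G]

theorem IsFormalAdjoint.inner_eq {S' : F →ₗ.[ℂ] E} {S : E →ₗ.[ℂ] F} (h : S'.IsFormalAdjoint S)
    {y : F} {z : E} {u : E} {v : F} (hy : (y, z) ∈ S'.graph) (hu : (u, v) ∈ S.graph) :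
    inner ℂ z u = inner ℂ y v := by
  obtain ⟨y, rfl, rfl⟩ := (mem_graph_iff _).mp hy
  obtain ⟨u, rfl, rfl⟩ := (mem_graph_iff _).mp hu
  exact h y u

variable [CompleteSpace E]

/-- An operator whose graph is `{(U w, V w)}`, for commuting self-adjoint bounded operators `U`
and `V`, is self-adjoint if this graph is maximal. -/
theorem isSelfAdjoint_of_graph {A : E →ₗ.[ℂ] E} {U V : E →L[ℂ] E} (hU : IsSelfAdjoint U)
    (hV : IsSelfAdjoint V) (hUV : Commute U V) (hinj : ∀ x, U x = 0 → x = 0)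
    (hA : ∀ x z, (x, z) ∈ A.graph ↔ ∃ w, x = U w ∧ z = V w)
    (hmax : ∀ a b, U b = V a → ∃ w, a = U w ∧ b = V w) : IsSelfAdjoint A := by
  have hUs : ∀ x y, inner ℂ (U x) y = inner ℂ x (U y) := fun x y => hU.isSymmetric x y
  have hVs : ∀ x y, inner ℂ (V x) y = inner ℂ x (V y) := fun x y => hV.isSymmetric x y
  have hd : Dense (A.domain : Set E) := by
    rw [Submodule.dense_iff_topologicalClosure_eq_top, Submodule.topologicalClosure_eq_top_iff,
      Submodule.eq_bot_iff]
    intro x hx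
    refine hinj x (ext_inner_left ℂ fun w => ?_)
    rw [← hUs, inner_zero_right]
    exact (Submodule.mem_orthogonal _ _).mp hx _
      (mem_domain_of_mem_graph ((hA _ _).mpr ⟨w, rfl, rfl⟩))
  rw [isSelfAdjoint_def]
  refine eq_of_eq_graph ?_
  ext ⟨a, b⟩
  rw [adjoint_graph_eq_graph_adjoint hd, Submodule.mem_adjoint_iff, hA]
  constructor
  · intro h
    -- Since `U` and `V` are self-adjoint, `(a, b)` lies in the adjoint graph exactly when `U b = V
    -- a`.
    refine hmax a b (ext_inner_left ℂ fun w => ?_)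
    have := h _ _ ((hA _ _).mpr ⟨w, rfl, rfl⟩)
    rw [← hUs, ← hVs]
    exact (sub_eq_zero.mp this).symm
  · rintro ⟨w, rfl, rfl⟩ x z hxz
    obtain ⟨v, rfl, rfl⟩ := (hA _ _).mp hxz
    rw [hUs, hVs, sub_eq_zero]
    exact congrArg (inner ℂ v) (DFunLike.congr_fun hUV.eq w).symm

/-- If `1 + S' S` is onto, where `S'` is a formal adjoint of the closed operator `S`, then the domain
of `S' S` is a core for `S`. -/
theorem exists_seq_domain_pcomp [CompleteSpace F] {S : E →ₗ.[ℂ] F} {S' : F →ₗ.[ℂ] E}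
    (hS : S.IsClosed) (h : S'.IsFormalAdjoint S)
    (hsurj : ∀ w, ∃ x z, (x, z) ∈ (S'.pcomp S).graph ∧ w = x + z)
    {u : E} {f : F} (hu : (u, f) ∈ S.graph) :
    ∃ w : ℕ → E × F, (∀ n, w n ∈ S.graph ∧ (w n).1 ∈ (S'.pcomp S).domain) ∧
      Tendsto (fun n => (w n).1) atTop (𝓝 u) ∧ Tendsto (fun n => (w n).2) atTop (𝓝 f) := by
  obtain ⟨w, h1, h2⟩ := Submodule.exists_seq_tendsto_of_orthogonal (g := S.graph)
    (g' := S.graph ⊓ (S'.pcomp S).domain.comap (LinearMap.fst ℂ E F)) hS inf_le_left hu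
    fun q hq hqr => by
      -- Writing `q.1 = x + S' S x`, orthogonality of `q` to `(x, S x)` reads `⟪x + S' S x, q.1⟫ =
      -- 0`, that is, `q.1 = 0`.
      obtain ⟨x, z, hxz, hw⟩ := hsurj q.1
      obtain ⟨y, hxy, hyz⟩ := (mem_graph_pcomp _ _).mp hxz
      have h0 : q.1 = 0 := by
        have h3 := hqr (x, y) ⟨hxy, mem_domain_of_mem_graph hxz⟩
        rw [← h.inner_eq hyz hq, ← inner_add_left, ← hw, inner_self_eq_zero] at h3
        exact h3
      have h4 : q.2 = 0 := S.graph_fst_eq_zero_snd hq h0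
      rw [h0, h4, inner_zero_left, inner_zero_left, add_zero]
  exact ⟨fun n => w n, fun n => (w n).2, h1, h2⟩

/-- Two closed operators with `S' S = R' R` have the same domain and the same norms. -/
theorem exists_mem_graph_norm_eq [CompleteSpace F] [CompleteSpace G] {S : E →ₗ.[ℂ] F}
    {S' : F →ₗ.[ℂ] E} {R : E →ₗ.[ℂ] G} {R' : G →ₗ.[ℂ] E} (hS : S.IsClosed)
    (hS' : S'.IsFormalAdjoint S) (hR : R.IsClosed) (hR' : R'.IsFormalAdjoint R)
    (hSR : S'.pcomp S = R'.pcomp R)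
    (hsurj : ∀ w, ∃ x z, (x, z) ∈ (S'.pcomp S).graph ∧ w = x + z)
    {u : E} {f : F} (hu : (u, f) ∈ S.graph) : ∃ g, (u, g) ∈ R.graph ∧ ‖g‖ = ‖f‖ := by
  -- On the common domain, `‖R x‖² = ⟪R' R x, x⟫ = ⟪S' S x, x⟫ = ‖S x‖²`. The core property then
  -- carries this to all of `Dom S`.
  have key : ∀ x y, (x, y) ∈ S.graph → x ∈ (S'.pcomp S).domain →
      ∃ v, (x, v) ∈ R.graph ∧ ‖v‖ = ‖y‖ := by
    intro x y hxy hx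
    obtain ⟨z, hz⟩ := mem_domain_iff.mp hx
    obtain ⟨y', hxy', hyz⟩ := (mem_graph_pcomp _ _).mp hz
    obtain rfl : y = y' := S.mem_graph_snd_inj hxy hxy' rfl
    rw [hSR] at hz
    obtain ⟨v, hxv, hvz⟩ := (mem_graph_pcomp _ _).mp hz
    refine ⟨v, hxv, ?_⟩
    have h1 : inner ℂ v v = inner ℂ y y := (hR'.inner_eq hvz hxv).symm.trans (hS'.inner_eq hyz hxy)
    rw [norm_eq_sqrt_re_inner (𝕜 := ℂ), norm_eq_sqrt_re_inner (𝕜 := ℂ), h1]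
  obtain ⟨w, hw, h1, h2⟩ := exists_seq_domain_pcomp hS hS' hsurj hu
  choose v hv hvn using fun n => key _ _ (hw n).1 (hw n).2
  have hdist : ∀ m n, dist (v m) (v n) = dist (w m).2 (w n).2 := fun m n => by
    obtain ⟨v', hv', hvn'⟩ := key _ _ (S.graph.sub_mem (hw m).1 (hw n).1)
      ((S'.pcomp S).domain.sub_mem (hw m).2 (hw n).2)
    have : v m - v n = v' := R.mem_graph_snd_inj (R.graph.sub_mem (hv m) (hv n)) hv' rfl
    rw [dist_eq_norm, this, hvn', dist_eq_norm]
  have hc : CauchySeq v := Metric.cauchySeq_iff.mpr fun ε hε => by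
    simpa only [hdist] using Metric.cauchySeq_iff.mp h2.cauchySeq ε hε
  obtain ⟨g, hg⟩ := cauchySeq_tendsto_of_complete hc
  refine ⟨g, hR.mem_of_tendsto (h1.prodMk_nhds hg) (Eventually.of_forall hv), ?_⟩
  exact tendsto_nhds_unique hg.norm (h2.norm.congr fun n => (hvn n).symm)

/-- The graph of `e e*` is `{(R w, (1 - R) w)}`, where `R = (1 + e e*)⁻¹`. -/
theorem exists_resolvent [CompleteSpace F] {e : F →ₗ.[ℂ] E} (he : e.IsClosed)
    (hd : Dense (e.domain : Set F)) :
    ∃ R V : E →L[ℂ] E, R.IsPositive ∧ V.IsPositive ∧ R + V = 1 ∧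
      ∀ x z, (x, z) ∈ (e.pcomp e.adjoint).graph ↔ ∃ w, x = R w ∧ z = V w := by
  let Φ := WithLp.prodContinuousLinearEquiv 2 ℂ F E
  let g : Submodule ℂ (WithLp 2 (F × E)) := e.graph.comap Φ.toLinearEquiv.toLinearMap
  have hg : _root_.IsClosed (g : Set (WithLp 2 (F × E))) := he.preimage Φ.continuous
  have : CompleteSpace g := hg.completeSpace_coe
  let s : WithLp 2 (F × E) →L[ℂ] E := WithLp.sndL 2 ℂ F E
  have hs : ∀ w, s.adjoint w = WithLp.toLp 2 (0, w) := fun w => by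
    refine ext_inner_left ℂ fun p => ?_
    rw [ContinuousLinearMap.adjoint_inner_right, WithLp.prod_inner_apply]
    simp [s]
  have horth : ∀ x y, WithLp.toLp 2 (-y, x) ∈ gᗮ ↔ (x, y) ∈ e.adjoint.graph := fun x y => by
    rw [adjoint_graph_eq_graph_adjoint hd, Submodule.mem_adjoint_iff, Submodule.mem_orthogonal]
    constructor
    · intro h a b hab
      have := h (WithLp.toLp 2 (a, b)) hab
      rw [WithLp.prod_inner_apply] at this
      simpa [sub_eq_neg_add] using this
    · intro h p hp
      have := h _ _ hp
      rw [WithLp.prod_inner_apply]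
      simpa [sub_eq_neg_add] using this
  -- Split `(0, w) = (y, z) + (-y, x)` along the graph of `e` and its complement. Then `z = e y`, `y
  -- = e* x` and `w = x + e e* x`; `V` reads off `z` and `R` reads off `x`.
  let V := s ∘L g.starProjection ∘L s.adjoint
  let R := s ∘L gᗮ.starProjection ∘L s.adjoint
  have hRV : R + V = 1 := by
    ext w
    have h1 := g.starProjection_add_starProjection_orthogonal (s.adjoint w)
    have h2 := congrArg s h1
    rw [_root_.map_add, add_comm] at h2
    refine h2.trans ?_
    rw [hs]
    rfl
  refine ⟨R, V, ?_, ?_, hRV, fun x z => ?_⟩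
  · exact (ContinuousLinearMap.IsPositive.of_isStarProjection
      isStarProjection_starProjection).conj_adjoint s
  · exact (ContinuousLinearMap.IsPositive.of_isStarProjection
      isStarProjection_starProjection).conj_adjoint s
  have hR : ∀ w, R w = w - V w := fun w => by
    rw [eq_sub_iff_add_eq]
    exact DFunLike.congr_fun hRV w
  rw [mem_graph_pcomp]
  constructor
  · rintro ⟨y, hxy, hyz⟩
    have h1 : g.starProjection (WithLp.toLp 2 (0, x + z)) = WithLp.toLp 2 (y, z) := by
      refine Submodule.eq_starProjection_of_mem_orthogonal (show _ ∈ g from hyz) ?_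
      rw [← WithLp.toLp_sub, Prod.mk_sub_mk, zero_sub, add_sub_cancel_right]
      exact (horth x y).mpr hxy
    have h2 : V (x + z) = z := by
      change s (g.starProjection (s.adjoint (x + z))) = z
      rw [hs, h1]
      rfl
    exact ⟨x + z, by rw [hR, h2, add_sub_cancel_right], h2.symm⟩
  · rintro ⟨w, rfl, rfl⟩
    have h1 : (g.starProjection (WithLp.toLp 2 (0, w))) ∈ g := Submodule.starProjection_apply_mem _ _
    have h2 : WithLp.toLp 2 (0, w) - g.starProjection (WithLp.toLp 2 (0, w)) ∈ gᗮ :=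
      Submodule.sub_starProjection_mem_orthogonal _
    have h3 : V w = (g.starProjection (WithLp.toLp 2 (0, w))).snd := by
      change s (g.starProjection (s.adjoint w)) = _
      rw [hs]
      rfl
    refine ⟨(g.starProjection (WithLp.toLp 2 (0, w))).fst, ?_, ?_⟩
    · rw [← horth, hR, h3]
      convert! h2 using 1
      exact (WithLp.equiv 2 (F × E)).injective (Prod.ext (by simp) (by simp))
    · rw [h3]
      exact h1

/-- The operator with graph `{(Q x, W x)}` where `Q = √R` and `W = √(1 - R)`. -/
theorem exists_sqrt {A : E →ₗ.[ℂ] E} {R V : E →L[ℂ] E} (hR : R.IsPositive) (hV : V.IsPositive)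
    (hRV : R + V = 1) (hA : ∀ x z, (x, z) ∈ A.graph ↔ ∃ w, x = R w ∧ z = V w) :
    A.IsPosSelfAdjoint ∧ ∃ B : E →ₗ.[ℂ] E, B.IsPosSelfAdjoint ∧ B.pcomp B = A := by
  have hR0 : 0 ≤ R := (ContinuousLinearMap.nonneg_iff_isPositive R).mpr hR
  have hV0 : 0 ≤ V := (ContinuousLinearMap.nonneg_iff_isPositive V).mpr hV
  have hRVc : Commute R V := by
    rw [← eq_sub_iff_add_eq'] at hRV
    rw [hRV]
    exact (Commute.one_right R).sub_right (Commute.refl R)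
  have hadd : ∀ w, R w + V w = w := fun w => DFunLike.congr_fun hRV w
  -- If `R x = 0`, then `(0, V x)` is in the graph of `A`, so `V x = 0` and `x = R x + V x = 0`.
  have hRinj : ∀ x, R x = 0 → x = 0 := fun x hx => by
    have h1 : V x = 0 := A.graph_fst_eq_zero_snd ((hA _ _).mpr ⟨x, rfl, rfl⟩) hx
    rw [← hadd x, hx, h1, add_zero]
  set Q := CFC.sqrt R
  set W := CFC.sqrt V
  have hQQ : Q * Q = R := CFC.sqrt_mul_sqrt_self R hR0
  have hWW : W * W = V := CFC.sqrt_mul_sqrt_self V hV0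
  have hQ0 : 0 ≤ Q := CFC.sqrt_nonneg R
  have hW0 : 0 ≤ W := CFC.sqrt_nonneg V
  have hc : Commute Q W := ((hRVc.cfcₙ_nnreal _).symm.cfcₙ_nnreal _).symm
  have hQQa : ∀ x, Q (Q x) = R x := fun x => DFunLike.congr_fun hQQ x
  have hWWa : ∀ x, W (W x) = V x := fun x => DFunLike.congr_fun hWW x
  have hca : ∀ x, Q (W x) = W (Q x) := fun x => DFunLike.congr_fun hc.eq x
  have hQinj : ∀ x, Q x = 0 → x = 0 := fun x hx => hRinj x (by rw [← hQQa, hx, _root_.map_zero])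
  let B : E →ₗ.[ℂ] E := (LinearMap.range (Q.prod W).toLinearMap).toLinearPMap
  have hB : ∀ x z, (x, z) ∈ B.graph ↔ ∃ w, x = Q w ∧ z = W w := fun x z => by
    rw [Submodule.toLinearPMap_graph_eq]
    · constructor
      · rintro ⟨w, hw⟩
        exact ⟨w, (congrArg Prod.fst hw).symm, (congrArg Prod.snd hw).symm⟩
      · rintro ⟨w, rfl, rfl⟩
        exact ⟨w, rfl⟩
    · rintro _ ⟨w, rfl⟩ h
      have : w = 0 := hQinj w h
      rw [this, _root_.map_zero, Prod.snd_zero]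
  -- With commuting positive `U` and `Z`, `⟪U w, Z w⟫ = ⟪w, U Z w⟫ ≥ 0`.
  have pos : ∀ {C : E →ₗ.[ℂ] E} {U Z : E →L[ℂ] E}, 0 ≤ U → 0 ≤ Z → Commute U Z →
      (∀ x z, (x, z) ∈ C.graph ↔ ∃ w, x = U w ∧ z = Z w) →
      ∀ x : C.domain, 0 ≤ inner ℂ (x : E) (C x) := by
    intro C U Z hU hZ hUZ hC x
    obtain ⟨w, h1, h2⟩ := (hC _ _).mp (C.mem_graph x)
    have h3 := ((ContinuousLinearMap.nonneg_iff_isPositive _).mp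
      (Commute.mul_nonneg hU hZ hUZ)).inner_nonneg_right w
    rw [h1, h2]
    exact h3.trans_eq (hU.isSelfAdjoint.isSymmetric w (Z w)).symm
  -- The maximality witnesses come from `R + V = 1` and `Q² + W² = 1`: if `R b = V a`, then `R (a +
  -- b) = R a + V a = a`; if `Q b = W a`, then `Q (Q a + W b) = R a + V a = a`. The second
  -- components are symmetric.
  refine ⟨⟨isSelfAdjoint_of_graph hR0.isSelfAdjoint hV0.isSelfAdjoint hRVc hRinj hA
    fun a b hab => ⟨a + b, ?_, ?_⟩, pos hR0 hV0 hRVc hA⟩, B,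
    ⟨isSelfAdjoint_of_graph hQ0.isSelfAdjoint hW0.isSelfAdjoint hc hQinj hB
      fun a b hab => ⟨Q a + W b, ?_, ?_⟩, pos hQ0 hW0 hc hB⟩, eq_of_eq_graph ?_⟩
  · rw [_root_.map_add, hab, hadd]
  · rw [_root_.map_add, ← hab, hadd]
  · rw [_root_.map_add, hca, hab, hQQa, hWWa, hadd]
  · rw [_root_.map_add, ← hca, ← hab, hQQa, hWWa, hadd]
  · ext ⟨x, z⟩
    rw [mem_graph_pcomp, hA]
    constructor
    · rintro ⟨y, hxy, hyz⟩
      obtain ⟨a, rfl, rfl⟩ := (hB _ _).mp hxy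
      obtain ⟨b, hab, rfl⟩ := (hB _ _).mp hyz
      -- Here `W a = Q b`, so `R (Q a + W b) = Q (R a + V a) = Q a`, and similarly `V (Q a + W b) =
      -- W b`.
      refine ⟨Q a + W b, ?_, ?_⟩
      · rw [_root_.map_add, ← hQQa (W b), hca b, ← hab, hWWa, ← hQQa (Q a), hQQa a,
          ← _root_.map_add, hadd]
      · rw [_root_.map_add, ← hWWa (Q a), ← hca a, hab, hQQa, ← hWWa (W b), hWWa b, ← _root_.map_add,
          hadd]
    · rintro ⟨w, rfl, rfl⟩
      exact ⟨W (Q w), (hB _ _).mpr ⟨Q w, (hQQa w).symm, rfl⟩,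
        (hB _ _).mpr ⟨W w, (hca w).symm, (hWWa w).symm⟩⟩

end LinearPMap

/-- The form `(u, v) ↦ ⟪e* u, e* v⟫` is the form of the positive self-adjoint operator `e e*`. -/
theorem PosForm.isFormOf_ofOp_adjoint {E F : Type*} [NormedAddCommGroup E] [InnerProductSpace ℂ E]
    [CompleteSpace E] [NormedAddCommGroup F] [InnerProductSpace ℂ F] [CompleteSpace F]
    {e : F →ₗ.[ℂ] E} (he : e.IsClosed) (hd : Dense (e.domain : Set F))
    (hd' : Dense (e.adjoint.domain : Set E)) :
    (ofOp e.adjoint hd').IsFormOf (e.pcomp e.adjoint) := by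
  obtain ⟨R, V, hR, hV, hRV, hA⟩ := LinearPMap.exists_resolvent he hd
  obtain ⟨hpos, B, hB, hBA⟩ := LinearPMap.exists_sqrt hR hV hRV hA
  have hsurj : ∀ w, ∃ x z, (x, z) ∈ (e.pcomp e.adjoint).graph ∧ w = x + z := fun w =>
    ⟨R w, V w, (hA _ _).mpr ⟨w, rfl, rfl⟩, (DFunLike.congr_fun hRV w).symm⟩
  have hB' : B.IsFormalAdjoint B := by
    have := LinearPMap.adjoint_isFormalAdjoint hB.1.dense_domain
    rwa [LinearPMap.isSelfAdjoint_def.mp hB.1] at this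
  have he' : e.IsFormalAdjoint e.adjoint := (LinearPMap.adjoint_isFormalAdjoint hd).symm
  have hec := LinearPMap.adjoint_isClosed hd
  -- Since `B B = e e*`, the comparison of closed operators applies to `e*` and `B`, in both
  -- directions for the domains.
  have h1 : ∀ u : e.adjoint.domain, ∃ h : (u : E) ∈ B.domain, ‖B ⟨u, h⟩‖ = ‖e.adjoint u‖ := fun u => by
    obtain ⟨g, hg, hn⟩ := LinearPMap.exists_mem_graph_norm_eq hec he' hB.1.isClosed hB' hBA.symm hsurj
      (e.adjoint.mem_graph u)
    obtain ⟨v, hv, rfl⟩ := (LinearPMap.mem_graph_iff _).mp hg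
    obtain ⟨v, hv0⟩ := v
    obtain rfl : v = u := hv
    exact ⟨hv0, hn⟩
  have hdom : e.adjoint.domain = B.domain := le_antisymm (fun u hu => (h1 ⟨u, hu⟩).1) fun u hu => by
    obtain ⟨g, hg, -⟩ := LinearPMap.exists_mem_graph_norm_eq hB.1.isClosed hB' hec he' hBA
      (hBA.symm ▸ hsurj) (B.mem_graph ⟨u, hu⟩)
    exact LinearPMap.mem_domain_of_mem_graph hg
  refine ⟨hpos, B, hB, hBA, hdom, fun x y => ?_⟩
  have hext : (ofOp B hB.1.dense_domain).Extends (ofOp e.adjoint hd') :=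
    Extends.of_quad hdom.le fun u => by
      refine (quad_ofOp B _ ⟨u, hdom.le u.2⟩).trans (Eq.trans ?_ (quad_ofOp _ hd' u).symm)
      exact congrArg (· ^ 2) (h1 u).2
  exact (hext.2 x y).symm

/-! ### The Simon--Lebesgue decomposition of the form of an operator -/

namespace PosForm

variable {E F : Type*} [NormedAddCommGroup E] [InnerProductSpace ℂ E]
  [NormedAddCommGroup F] [InnerProductSpace ℂ F]
  {T : E →ₗ.[ℂ] F} {M : Submodule ℂ F}

/-- If `e` is the adjoint of `T`, considered as an operator in the closure `M` of its domain, then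
`e*` extends the part of `T` in `M`. -/
theorem compPMap_le_adjoint [CompleteSpace M] {e : M →ₗ.[ℂ] E} (hd : Dense (e.domain : Set M))
    (he : ∀ (m : e.domain) (v : T.domain), inner ℂ (e m) (v : E) = inner ℂ ((m : M) : F) (T v)) :
    M.orthogonalProjectionOnto.toLinearMap.compPMap T ≤ e.adjoint := by
  refine LinearPMap.IsFormalAdjoint.le_adjoint hd fun m v => (he m v).trans ?_
  exact (Submodule.inner_orthogonalProjectionOnto_eq_of_mem_left (m : M) (T v)).symm

variable [CompleteSpace E]

/-- The form of `T` splits along the closure `M` of the domain of `T*`. -/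
theorem isSimonLebesgue_ofOp [CompleteSpace F] (hT : Dense (T.domain : Set E)) [M.HasOrthogonalProjection]
    (hM : ∀ a b, (∀ v : T.domain, inner ℂ (v : E) a + inner ℂ (T v) b = 0) → b ∈ M)
    (hcl : (ofOp (M.starProjection.toLinearMap.compPMap T) hT).Closeable) :
    (ofOp T hT).IsSimonLebesgue (ofOp (M.starProjection.toLinearMap.compPMap T) hT)
      (ofOp (Mᗮ.starProjection.toLinearMap.compPMap T) hT) := by
  have hsq : ∀ f : F, ‖f‖ ^ 2 = ‖M.starProjection f‖ ^ 2 + ‖Mᗮ.starProjection f‖ ^ 2 := fun f =>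
    Submodule.norm_sq_eq_add_norm_sq_starProjection f M
  have hac : ∀ u : T.domain, (ofOp (M.starProjection.toLinearMap.compPMap T) hT).quad u =
      ‖M.starProjection (T u)‖ ^ 2 := fun u =>
    quad_ofOp (M.starProjection.toLinearMap.compPMap T) hT u
  have hs : ∀ u : T.domain, (ofOp (Mᗮ.starProjection.toLinearMap.compPMap T) hT).quad u =
      ‖Mᗮ.starProjection (T u)‖ ^ 2 := fun u =>
    quad_ofOp (Mᗮ.starProjection.toLinearMap.compPMap T) hT u
  refine ⟨rfl, rfl, fun x y => ?_, hcl, ⟨le_rfl, fun u => ?_⟩, fun p hp hle => ⟨hle.1, fun u => ?_⟩,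
    fun p hp hle => p.form_eq_zero_of_quad_eq_zero fun u => le_antisymm ?_ (p.quad_nonneg u)⟩
  · change inner ℂ (T x) (T y) = inner ℂ (M.starProjection (T x)) (M.starProjection (T y)) +
      inner ℂ (Mᗮ.starProjection (T x)) (Mᗮ.starProjection (T y))
    rw [Submodule.inner_starProjection_left_eq_right, Submodule.inner_starProjection_left_eq_right,
      Submodule.starProjection_eq_self_iff.mpr (Submodule.starProjection_apply_mem _ _),
      Submodule.starProjection_eq_self_iff.mpr (Submodule.starProjection_apply_mem _ _),
      ← inner_add_right, Submodule.starProjection_add_starProjection_orthogonal]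
  · refine (hac u).trans_le (LE.le.trans_eq ?_ (quad_ofOp T hT u).symm)
    rw [hsq (T u)]
    exact le_add_of_nonneg_right (by positivity)
  -- Maximality: `(u, P T u)` is in the closure of the graph of `T`, because any `(a, b)` orthogonal
  -- to the graph has `b ∈ M`, and so does not distinguish `T u` from `P T u`.
  · obtain ⟨w, hw, hTw⟩ := T.exists_seq_tendsto_of_orthogonal (u := (u : E))
      (f := M.starProjection (T u)) fun a b hab => by
        have hb := hM a b hab
        rw [← Submodule.inner_starProjection_left_eq_right,
          Submodule.starProjection_eq_self_iff.mpr hb]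
        have := congrArg (starRingEnd ℂ) (hab u)
        rwa [map_add, inner_conj_symm, inner_conj_symm, map_zero] at this
    exact (quad_le_of_tendsto hp hle (u := ⟨u, hle.1 u.2⟩) hw hTw).trans_eq (hac u).symm
  -- Singularity: if `(a, b)` is orthogonal to the graph of `(1 - P) T`, then `(a, (1 - P) b)` is
  -- orthogonal to that of `T`. So `(1 - P) b` lies in `M ∩ Mᗮ = 0`, and `a = 0` by density. Hence
  -- `(u, 0)` is in the closure of the graph.
  · obtain ⟨w, hw, hTw⟩ := (Mᗮ.starProjection.toLinearMap.compPMap T).exists_seq_tendsto_of_orthogonal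
      (u := (u : E)) (f := 0) fun a b hab => by
        have hb : Mᗮ.starProjection b = 0 := by
          have h1 : Mᗮ.starProjection b ∈ M := hM a _ fun v => by
            rw [← Submodule.inner_starProjection_left_eq_right]
            exact hab v
          have h2 : Mᗮ.starProjection b ∈ Mᗮ := Submodule.starProjection_apply_mem _ _
          exact inner_self_eq_zero.mp ((Submodule.mem_orthogonal _ _).mp h2 _ h1)
        have ha : a = 0 := hT.eq_zero_of_inner_right ℂ fun v hv => by
          have h1 := hab ⟨v, hv⟩
          have h2 : inner ℂ (Mᗮ.starProjection (T ⟨v, hv⟩)) b = 0 := by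
            rw [Submodule.inner_starProjection_left_eq_right, hb, inner_zero_right]
          exact (add_eq_left.mpr h2).symm.trans h1
        rw [ha, inner_zero_left, inner_zero_right, add_zero]
    exact (quad_le_of_tendsto hp hle hw hTw).trans_eq (by simp)

/-- The closure of `P T` is `e*`: a pair orthogonal to the graph of `P T` in `E × M` has the form
`(-e b, b)`, and such pairs are orthogonal to the graph of `e*`. So `Dom T` is a core for `e*`. -/
theorem exists_isClosureOf_ofOp [CompleteSpace M] {e : M →ₗ.[ℂ] E}
    (hT : Dense (T.domain : Set E)) (hd : Dense (e.domain : Set M))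
    (hc : e.IsClosed)
    (he : ∀ (m : e.domain) (v : T.domain), inner ℂ (e m) (v : E) = inner ℂ ((m : M) : F) (T v))
    (he' : ∀ a b, (∀ v : T.domain, inner ℂ (v : E) a + inner ℂ (T v) b = 0) →
      ∃ h : b ∈ M, (⟨b, h⟩, -a) ∈ e.graph) :
    ∃ q : PosForm E, q.IsClosureOf (ofOp (M.starProjection.toLinearMap.compPMap T) hT) ∧
      q.IsFormOf (e.pcomp e.adjoint) := by
  have hle := compPMap_le_adjoint hd he
  have hd' : Dense (e.adjoint.domain : Set E) := hT.mono hle.1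
  have heq : ofOp (M.starProjection.toLinearMap.compPMap T) hT =
      ofOp (M.orthogonalProjectionOnto.toLinearMap.compPMap T) hT := rfl
  refine ⟨ofOp e.adjoint hd', ?_, isFormOf_ofOp_adjoint hc hd hd'⟩
  rw [heq]
  refine isClosureOf_ofOp (LinearPMap.adjoint_isClosed hd) hd' hT hle fun u =>
    LinearPMap.exists_seq_tendsto_of_orthogonal _ fun a b hab => ?_
  obtain ⟨hb, hg⟩ := he' a b fun v => by
    refine Eq.trans ?_ (hab v)
    exact congrArg _ (Submodule.inner_orthogonalProjectionOnto_eq_of_mem_right b (T v)).symm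
  have h1 := (LinearPMap.adjoint_isFormalAdjoint hd).symm.inner_eq hg (e.adjoint.mem_graph u)
  rw [inner_neg_left] at h1
  exact (eq_neg_iff_add_eq_zero.mp (neg_eq_iff_eq_neg.mp h1))

end PosForm

/-! ### Kernels of closed subspaces -/

namespace PosKernel

variable {X : Type*}

theorem posSemidef_of_inner {F : Type*} [NormedAddCommGroup F] [InnerProductSpace ℂ F]
    (Φ : X → F) : (Matrix.of fun x y => inner ℂ (Φ x) (Φ y)).PosSemidef := by
  refine ⟨?_, fun c => ?_⟩
  · ext x y
    exact inner_conj_symm (Φ x) (Φ y)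
  · have h : (c.sum fun x a => c.sum fun y b =>
        star a * (Matrix.of fun x y => inner ℂ (Φ x) (Φ y)) x y * b) =
        inner ℂ (Finsupp.linearCombination ℂ Φ c) (Finsupp.linearCombination ℂ Φ c) := by
      simp only [Finsupp.linearCombination_apply, Finsupp.sum, sum_inner, inner_sum,
        inner_smul_left, inner_smul_right, Matrix.of_apply, Complex.star_def, Finset.mul_sum]
      rw [Finset.sum_comm]
      refine Finset.sum_congr rfl fun x _ => Finset.sum_congr rfl fun y _ => ?_
      ring
    rw [h, inner_self_eq_norm_sq_to_K]
    exact (Complex.zero_le_real.mpr (sq_nonneg ‖Finsupp.linearCombination ℂ Φ c‖)).trans_eq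
      (Complex.ofReal_pow _ _)

/-- The reproducing kernel of the closed subspace `M` of `H(k)`. -/
noncomputable def restrict (k : PosKernel X) (M : Submodule ℂ k.H) [M.HasOrthogonalProjection] :
    PosKernel X where
  toFun x y := inner ℂ (M.starProjection (k.vec x)) (M.starProjection (k.vec y))
  posSemidef := posSemidef_of_inner fun x => M.starProjection (k.vec x)

theorem denseRange_linearCombination_vec (k : PosKernel X) :
    DenseRange (Finsupp.linearCombination ℂ k.vec) := by
  have h := k.dense_kernelSpan
  rw [kernelSpan, ← Finsupp.range_linearCombination] at h
  exact h

theorem continuousLinearMap_ext_vec {k : PosKernel X} {F : Type*} [NormedAddCommGroup F]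
    [NormedSpace ℂ F] {A B : k.H →L[ℂ] F} (h : ∀ x, A (k.vec x) = B (k.vec x)) : A = B :=
  ContinuousLinearMap.ext_on k.dense_kernelSpan (by rintro _ ⟨x, rfl⟩; exact h x)

/-- A map from `X` to a Hilbert space whose Gram kernel is `k` induces an isometry on `H(k)`. -/
theorem exists_isometry_of_gram (k : PosKernel X) {F : Type*} [NormedAddCommGroup F]
    [InnerProductSpace ℂ F] [CompleteSpace F] {Φ : X → F} (h : ∀ x y, inner ℂ (Φ x) (Φ y) = k x y) :
    ∃ J : k.H →ₗᵢ[ℂ] F, ∀ x, J (k.vec x) = Φ x := by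
  have hnorm : ∀ c, ‖Finsupp.linearCombination ℂ Φ c‖ = ‖Finsupp.linearCombination ℂ k.vec c‖ := by
    intro c
    rw [norm_eq_sqrt_re_inner (𝕜 := ℂ), norm_eq_sqrt_re_inner (𝕜 := ℂ)]
    simp only [Finsupp.linearCombination_apply, Finsupp.sum, sum_inner, inner_sum, inner_smul_left,
      inner_smul_right, h, inner_vec_vec]
  have hbd : ∀ c, ‖Finsupp.linearCombination ℂ Φ c‖ ≤ 1 * ‖Finsupp.linearCombination ℂ k.vec c‖ :=
    fun c => by rw [one_mul, hnorm]
  have heq : ∀ c, (Finsupp.linearCombination ℂ Φ).extendOfNorm (Finsupp.linearCombination ℂ k.vec)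
      (Finsupp.linearCombination ℂ k.vec c) = Finsupp.linearCombination ℂ Φ c :=
    LinearMap.extendOfNorm_eq k.denseRange_linearCombination_vec ⟨1, hbd⟩
  let J := (Finsupp.linearCombination ℂ Φ).extendOfNorm (Finsupp.linearCombination ℂ k.vec)
  refine ⟨⟨J.toLinearMap, fun f => ?_⟩, fun x => ?_⟩
  · refine k.denseRange_linearCombination_vec.induction_on
      (p := fun f => ‖J f‖ = ‖f‖) f (isClosed_eq (by fun_prop) (by fun_prop)) fun c => ?_
    rw [← hnorm, ← heq]
  · have := heq (Finsupp.single x 1)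
    simpa using this

/-- The vectors `P k_x` have Gram kernel `k.restrict M`, which gives the isometry `J`. It preserves
function values because `⟪k_x, J f⟫ = ⟪P k_x, J f⟫`. -/
theorem exists_isometry_restrict (k : PosKernel X) (M : Submodule ℂ k.H) [CompleteSpace M] :
    ∃ J : (k.restrict M).H →ₗᵢ[ℂ] k.H, (∀ x, J ((k.restrict M).vec x) = M.starProjection (k.vec x)) ∧
      (∀ f x, J f x = f x) ∧ LinearMap.range J.toLinearMap = M := by
  obtain ⟨J, hJ⟩ := (k.restrict M).exists_isometry_of_gram
    (Φ := fun x => M.starProjection (k.vec x)) fun _ _ => rfl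
  have hP : ∀ f, M.starProjection (J f) = J f := by
    have : M.starProjection ∘L J.toContinuousLinearMap = J.toContinuousLinearMap :=
      continuousLinearMap_ext_vec fun x => by
        change M.starProjection (J _) = J _
        rw [hJ]
        exact Submodule.starProjection_eq_self_iff.mpr (Submodule.starProjection_apply_mem _ _)
    exact fun f => DFunLike.congr_fun this f
  have hle : LinearMap.range J.toLinearMap ≤ M := by
    rintro _ ⟨f, rfl⟩
    exact Submodule.starProjection_eq_self_iff.mp (hP f)
  refine ⟨J, hJ, fun f x => ?_, le_antisymm hle fun p hp => ?_⟩
  · rw [← inner_vec, ← hP, ← Submodule.inner_starProjection_left_eq_right, ← hJ, J.inner_map_map,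
      inner_vec]
  · have hM : IsClosed (M : Set k.H) := (completeSpace_coe_iff_isComplete.mp inferInstance).isClosed
    -- An element `q` of `M` orthogonal to the range satisfies `q x = ⟪P k_x, q⟫ = 0` for all `x`,
    -- so the range is dense in `M`; it is closed because `J` is isometric.
    have h1 := Submodule.mem_topologicalClosure_of_orthogonal hM hle hp fun q hq hqr => by
      have : q = 0 := RKHS.ext fun x => by
        rw [← inner_vec, ← Submodule.starProjection_eq_self_iff.mpr hq,
          ← Submodule.inner_starProjection_left_eq_right, ← hJ]
        exact (hqr _ ⟨_, rfl⟩).trans (by rw [RKHS.coe_zero, Pi.zero_apply])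
      rw [this, inner_zero_left]
    rwa [IsClosed.submodule_topologicalClosure_eq] at h1
    exact J.isometry.isClosedEmbedding.isClosed_range

theorem FormDefined.restrict {k K : PosKernel X} (h : k.FormDefined K) (M : Submodule ℂ k.H)
    [CompleteSpace M] : (k.restrict M).FormDefined K := by
  intro c hc y
  obtain ⟨J, hJ, hJf, -⟩ := k.exists_isometry_restrict M
  have h1 : Finsupp.linearCombination ℂ k.vec c = 0 := RKHS.ext fun z => by
    rw [linearCombination_apply_eq, h c hc, RKHS.coe_zero, Pi.zero_apply]
  have h2 : J (Finsupp.linearCombination ℂ (k.restrict M).vec c) =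
      M.starProjection (Finsupp.linearCombination ℂ k.vec c) := by
    rw [Finsupp.linearCombination_apply, Finsupp.linearCombination_apply, Finsupp.sum, Finsupp.sum,
      map_sum, map_sum]
    exact Finset.sum_congr rfl fun x _ => by rw [map_smul, map_smul, hJ]
  rw [← linearCombination_apply_eq, ← hJf, h2, h1, map_zero, RKHS.coe_zero, Pi.zero_apply]

/-- The operator `K_x ↦ k_x` from `H(K)` to `H(k)`, with domain the span of the `K_x`. -/
noncomputable def transferOp (k K : PosKernel X) (h : k.FormDefined K) : K.H →ₗ.[ℂ] k.H :=
  ⟨K.kernelSpan, transfer k K h⟩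

theorem kernelForm_eq_ofOp (k K : PosKernel X) (h : k.FormDefined K) :
    k.kernelForm K h = PosForm.ofOp (transferOp k K h) K.dense_kernelSpan := rfl

/-- Links kernels to operators: the isometry `J` carries the transfer operator of `k.restrict M` to
`P T`, since both send `K_x` to `P k_x`. -/
theorem kernelForm_restrict {k K : PosKernel X} (h : k.FormDefined K) (M : Submodule ℂ k.H)
    [CompleteSpace M] : (k.restrict M).kernelForm K (h.restrict M) =
      PosForm.ofOp (M.starProjection.toLinearMap.compPMap (transferOp k K h)) K.dense_kernelSpan := by
  obtain ⟨J, hJ, -, -⟩ := k.exists_isometry_restrict M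
  have key : ∀ u : K.kernelSpan, J (transfer (k.restrict M) K (h.restrict M) u) =
      M.starProjection (transfer k K h u) := by
    rintro ⟨u, hu⟩
    induction hu using Submodule.span_induction with
    | mem u hu =>
      obtain ⟨x, rfl⟩ := hu
      refine (congrArg J (transfer_vec _ _ _ x)).trans ((hJ x).trans ?_)
      exact congrArg M.starProjection (transfer_vec _ _ h x).symm
    | zero =>
      have h0 : (⟨0, Submodule.zero_mem _⟩ : K.kernelSpan) = 0 := rfl
      rw [h0, map_zero, map_zero, map_zero, map_zero]
    | add u v hu hv h1 h2 =>
      have h0 : (⟨u + v, Submodule.add_mem _ hu hv⟩ : K.kernelSpan) = ⟨u, hu⟩ + ⟨v, hv⟩ := rfl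
      rw [h0, map_add, map_add, map_add, map_add, h1, h2]
    | smul c u hu h1 =>
      have h0 : (⟨c • u, Submodule.smul_mem _ c hu⟩ : K.kernelSpan) = c • ⟨u, hu⟩ := rfl
      rw [h0, map_smul, map_smul, map_smul, map_smul, h1]
  refine PosForm.ext_of_form rfl fun u v => ?_
  change inner ℂ (transfer (k.restrict M) K (h.restrict M) u)
    (transfer (k.restrict M) K (h.restrict M) v) =
    inner ℂ (M.starProjection (transfer k K h u)) (M.starProjection (transfer k K h v))
  exact (J.inner_map_map _ _).symm.trans (congrArg₂ (inner ℂ) (key u) (key v))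

/-! ### The embedding of the intersection space -/

theorem mem_graph_embedding (k K : PosKernel X) {f : k.interClosure K} {g : K.H} :
    (f, g) ∈ (k.embedding K).graph ↔ ∀ x, (f : k.H) x = g x := by
  rw [embedding, Submodule.toLinearPMap_graph_eq]
  · rfl
  · intro p hp hp0
    refine RKHS.ext fun y => ?_
    have h1 : (p.1 : k.H) y = p.2 y := hp y
    rw [← h1, hp0, Submodule.coe_zero, RKHS.coe_zero, RKHS.coe_zero]

theorem isClosed_embedding (k K : PosKernel X) : (k.embedding K).IsClosed := by
  have h : ((k.embedding K).graph : Set (k.interClosure K × K.H)) =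
      ⋂ x, {p | (p.1 : k.H) x = p.2 x} := by
    ext ⟨f, g⟩
    rw [Set.mem_iInter]
    exact mem_graph_embedding k K
  rw [LinearPMap.IsClosed, h]
  refine isClosed_iInter fun x => isClosed_eq ?_ ?_
  · exact (RKHS.continuous_eval (𝕜 := ℂ) x).comp (continuous_subtype_val.comp continuous_fst)
  · exact (RKHS.continuous_eval (𝕜 := ℂ) x).comp continuous_snd

theorem dense_domain_embedding (k K : PosKernel X) :
    Dense ((k.embedding K).domain : Set (k.interClosure K)) := by
  intro f
  rw [closure_subtype]
  have hf : (f : k.H) ∈ closure (k.inter K : Set k.H) := f.2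
  refine closure_mono (fun g hg => ?_) hf
  exact ⟨⟨g, (k.inter K).le_topologicalClosure hg⟩, (mem_embedding_domain k K _).mpr hg, rfl⟩

/-- The inclusion `e ⊆ T*`: on `K_x` both sides are the conjugate of the value of `m` at `x`. -/
theorem inner_embedding (k K : PosKernel X) (h : k.FormDefined K) (m : (k.embedding K).domain)
    (v : (transferOp k K h).domain) :
    inner ℂ (k.embedding K m) (v : K.H) =
      inner ℂ ((m : k.interClosure K) : k.H) (transferOp k K h v) := by
  obtain ⟨v, hv⟩ := v
  have hv' : v ∈ Submodule.span ℂ (Set.range K.vec) := hv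
  change inner ℂ (k.embedding K m) v =
    inner ℂ ((m : k.interClosure K) : k.H) (transfer k K h ⟨v, hv'⟩)
  induction hv' using Submodule.span_induction with
  | mem u hu =>
    obtain ⟨x, rfl⟩ := hu
    rw [transfer_vec, ← inner_conj_symm, inner_vec, embedding_apply, ← inner_vec, inner_conj_symm]
  | zero =>
    have h0 : (⟨0, Submodule.zero_mem _⟩ : K.kernelSpan) = 0 := rfl
    rw [h0, map_zero, inner_zero_right, inner_zero_right]
  | add u w hu hw h1 h2 =>
    have h0 : (⟨u + w, Submodule.add_mem _ hu hw⟩ : K.kernelSpan) = ⟨u, hu⟩ + ⟨w, hw⟩ := rfl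
    rw [h0, map_add, inner_add_right, inner_add_right, h1 hu, h2 hw]
  | smul c u hu h1 =>
    have h0 : (⟨c • u, Submodule.smul_mem _ c hu⟩ : K.kernelSpan) = c • ⟨u, hu⟩ := rfl
    rw [h0, map_smul, inner_smul_right, inner_smul_right, h1 hu]

/-- The inclusion `T* ⊆ e`: testing on `K_x` gives `a x + b x = 0`, so `b` and `-a` are the same
function. -/
theorem mem_graph_embedding_of_orthogonal {k K : PosKernel X} (h : k.FormDefined K) (a : K.H)
    (b : k.H) (hab : ∀ v : (transferOp k K h).domain,
      inner ℂ (v : K.H) a + inner ℂ (transferOp k K h v) b = 0) :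
    ∃ hb : b ∈ k.interClosure K, (⟨b, hb⟩, -a) ∈ (k.embedding K).graph := by
  have hx : ∀ x, b x = (-a) x := fun x => by
    have h1 : inner ℂ (K.vec x) a + inner ℂ (k.vec x) b = 0 := by
      rw [← transfer_vec k K h x]
      exact hab ⟨K.vec x, K.vec_mem_kernelSpan x⟩
    rw [inner_vec, inner_vec] at h1
    rw [RKHS.coe_neg, Pi.neg_apply, eq_neg_iff_add_eq_zero, add_comm, h1]
  have hb : b ∈ k.inter K := ⟨(b, -a), hx, rfl⟩
  exact ⟨(k.inter K).le_topologicalClosure hb, (mem_graph_embedding k K).mpr hx⟩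

/-! ### The decomposition of the form of a kernel -/

theorem isSimonLebesgue_restrict {k K : PosKernel X} (h : k.FormDefined K) :
    (k.kernelForm K h).IsSimonLebesgue
      ((k.restrict (k.interClosure K)).kernelForm K (h.restrict _))
      ((k.restrict (k.interClosure K)ᗮ).kernelForm K (h.restrict _)) ∧
    ∃ q : PosForm K.H,
      q.IsClosureOf ((k.restrict (k.interClosure K)).kernelForm K (h.restrict _)) ∧
      q.IsFormOf ((k.embedding K).pcomp (k.embedding K).adjoint) := by
  rw [kernelForm_restrict h, kernelForm_restrict h, kernelForm_eq_ofOp]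
  obtain ⟨q, hq, hq'⟩ := PosForm.exists_isClosureOf_ofOp (T := transferOp k K h) K.dense_kernelSpan
    (dense_domain_embedding k K) (isClosed_embedding k K) (inner_embedding k K h)
    (mem_graph_embedding_of_orthogonal h)
  exact ⟨PosForm.isSimonLebesgue_ofOp _
    (fun a b hab => (mem_graph_embedding_of_orthogonal h a b hab).1) ⟨q, hq.1, hq.2.1⟩, q, hq, hq'⟩

theorem restrict_add_restrict_orthogonal (k : PosKernel X) (M : Submodule ℂ k.H)
    [CompleteSpace M] (x y : X) : k x y = k.restrict M x y + k.restrict Mᗮ x y := by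
  change _ = inner ℂ (M.starProjection (k.vec x)) (M.starProjection (k.vec y)) +
      inner ℂ (Mᗮ.starProjection (k.vec x)) (Mᗮ.starProjection (k.vec y))
  rw [Submodule.inner_starProjection_left_eq_right, Submodule.inner_starProjection_left_eq_right,
    Submodule.starProjection_eq_self_iff.mpr (Submodule.starProjection_apply_mem _ _),
    Submodule.starProjection_eq_self_iff.mpr (Submodule.starProjection_apply_mem _ _),
    ← inner_add_right, Submodule.starProjection_add_starProjection_orthogonal, inner_vec_vec]

end PosKernel

theorem theoremA1 {X : Type*} (k K : PosKernel X) (hk : k.FormDefined K) :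
    (∃ q_ac q_s : PosForm K.H, (k.kernelForm K hk).IsSimonLebesgue q_ac q_s) ∧
    ∀ q_ac q_s : PosForm K.H, (k.kernelForm K hk).IsSimonLebesgue q_ac q_s →
      ∃ (k_ac k_s : PosKernel X) (h_ac : k_ac.FormDefined K) (h_s : k_s.FormDefined K),
        q_ac = k_ac.kernelForm K h_ac ∧
        q_s = k_s.kernelForm K h_s ∧
        (∀ x y, k x y = k_ac x y + k_s x y) ∧
        (∃ (J_ac : k_ac.H →ₗᵢ[ℂ] k.H) (J_s : k_s.H →ₗᵢ[ℂ] k.H),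
          (∀ f x, J_ac f x = f x) ∧
          (∀ f x, J_s f x = f x) ∧
          LinearMap.range J_ac.toLinearMap ⟂ LinearMap.range J_s.toLinearMap ∧
          LinearMap.range J_ac.toLinearMap ⊔ LinearMap.range J_s.toLinearMap = ⊤ ∧
          LinearMap.range J_ac.toLinearMap = k.interClosure K) ∧
        Dense ((k.embedding K).domain : Set (k.interClosure K)) ∧
        (k.embedding K).IsClosed ∧
        ∃ q : PosForm K.H, q.IsClosureOf q_ac ∧
          q.IsFormOf ((k.embedding K).pcomp (k.embedding K).adjoint) := by
  obtain ⟨hdec, hclos⟩ := PosKernel.isSimonLebesgue_restrict hk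
  refine ⟨⟨_, _, hdec⟩, fun q_ac q_s hq => ?_⟩
  -- By uniqueness, an arbitrary decomposition is the one built from the two restricted kernels.
  obtain ⟨rfl, rfl⟩ := hdec.unique hq
  obtain ⟨J_ac, -, hJ_ac, hr_ac⟩ := k.exists_isometry_restrict (k.interClosure K)
  obtain ⟨J_s, -, hJ_s, hr_s⟩ := k.exists_isometry_restrict (k.interClosure K)ᗮ
  refine ⟨_, _, hk.restrict _, hk.restrict _, rfl, rfl, k.restrict_add_restrict_orthogonal _,
    ⟨J_ac, J_s, hJ_ac, hJ_s, ?_, ?_, hr_ac⟩, PosKernel.dense_domain_embedding k K,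
    PosKernel.isClosed_embedding k K, hclos⟩
  · rw [hr_ac, hr_s]
    exact Submodule.isOrtho_orthogonal_right _
  · rw [hr_ac, hr_s]
    exact Submodule.sup_orthogonal_of_hasOrthogonalProjection
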